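/- Consider $M\ge 1$ flows of data item requests sharing one cache. The requests are indexed by $n\in\mathbb Z$; request $n$ comes from flow $I_n\in\{1,\dots,M\}$ and asks for the data item $R_n$, where the pairs $(I_n,R_n)$ are independent and identically distributed. A request of flow $k$ asks for one of the pairwise distinct data items $d^{(k)}_1,d^{(k)}_2,\dots$ of that flow, and the flows do not overlap: $d^{(k)}_i\ne d^{(g)}_j$ for all $i,j$ whenever $k\ne g$. Let $C_0$ be the total size of all data items whose most recent request before request $0$ is later than the most recent request before request $0$ for the item $R_0$, i.e. of the items in front of $R_0$ in the move-to-front list; request $0$ is a miss of an LRU cache of size $x$ if $C_0>x$. Assume that $\mathbb P[I_0=k]=\nu_k>0$ with $\sum_{k=1}^M\nu_k=1$, that $\mathbb P[R_0=d^{(k)}_i\mid I_0=k]\sim c_k/i^{\alpha_k}$ as $i\to\infty$ with $c_k>0$ and $\alpha_k>1$, $1\le k\le M$, and that all data items of flow $k$ have the same size $s^{(k)}>0$. Let $$\widetilde\alpha_1=\min_{1\le k\le M}\alpha_k,\qquad S_1=\{k:\ 1\le k\le M,\ \alpha_k=\widetilde\alpha_1\},\qquad \gamma_1=\Gamma(1-1/\widetilde\alpha_1)\sum_{k\in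 S_1}s^{(k)}(c_k\nu_k)^{1/\widetilde\alpha_1}.$$ Then, as $x\to\infty$, for every $k\in S_1$, $$\mathbb P[C_0>x\mid I_0=k]\ \sim\ \frac{\Gamma(2-1/\widetilde\alpha_1)}{\widetilde\alpha_1-1}\,\frac{\gamma_1^{\widetilde\alpha_1-1}}{(\nu_kc_k)^{1-1/\widetilde\alpha_1}}\,\frac{c_k}{x^{\widetilde\alpha_1-1}},$$ and for every $k\in\{1,\dots,M\}\setminus S_1$, $$\mathbb P[C_0>x\mid I_0=k]\ \sim\ \frac{\Gamma(2-1/\alpha_k)}{\alpha_k-1}\,\frac{\gamma_1^{\widetilde\alpha_1-\widetilde\alpha_1/\alpha_k}}{(\nu_kc_k)^{1-1/\alpha_k}}\,\frac{c_k}{x^{\widetilde\alpha_1-\widetilde\alpha_1/\alpha_k}}.$$ Here $f\sim g$ means $f/g\to1$. -/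

import Mathlib

open MeasureTheory ProbabilityTheory Filter Asymptotics

/-- `M` request flows sharing one cache, under the independent reference model. The requests are
indexed by `n : ℤ`; request `n` is issued by the flow `I n` and asks for the data item `R n`. The
pairs `(I n, R n)` are independent and identically distributed. Flow `k` only requests data items
from its own list `item k 0, item k 1, …` of pairwise distinct items; here `item k i` is the item
number `i + 1` of flow `k`. Lists of different flows may overlap. -/
structure CacheFlows (M : ℕ) (D : Type*) [MeasurableSpace D] {Ω : Type*} [MeasurableSpace Ω]
    (P : Measure Ω) where
  /-- the flow which issues the `n`-th request -/
  I : ℤ → Ω → Fin M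
  /-- the data item which is requested by the `n`-th request -/
  R : ℤ → Ω → D
  measurable_I : ∀ n, Measurable (I n)
  measurable_R : ∀ n, Measurable (R n)
  indep : iIndepFun (fun (n : ℤ) (ω : Ω) => (I n ω, R n ω)) P
  ident : ∀ n : ℤ, IdentDistrib (fun ω => (I n ω, R n ω)) (fun ω => (I 0 ω, R 0 ω)) P P
  /-- the ordered list of the data items of each flow -/
  item : Fin M → ℕ → D
  item_injective : ∀ k, Function.Injective (item k)
  request_mem : ∀ n : ℤ, ∀ᵐ ω ∂P, ∃ i : ℕ, R n ω = item (I n ω) i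
  /-- the size of each data item -/
  size : D → ℝ

/-- In the move-to-front list just before request `n` is served, the item `d` stands in front of
the item `e`: the last request for `d` before `n` is more recent than the last request for `e`
before `n`, that is, some request for `d` before `n` is later than every request for `e`
before `n`. -/
def InFront {D : Type*} (r : ℤ → D) (n : ℤ) (d e : D) : Prop :=
  ∃ j : ℤ, j < n ∧ r j = d ∧ ∀ i : ℤ, j ≤ i → i < n → r i ≠ e

namespace CacheFlows

variable {M : ℕ} {D : Type*} [MeasurableSpace D] {Ω : Type*} [MeasurableSpace Ω] {P : Measure Ω}

/-- No data item belongs to two different flows. -/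
def NonOverlapping (F : CacheFlows M D P) : Prop :=
  ∀ k g : Fin M, k ≠ g → ∀ i j : ℕ, F.item k i ≠ F.item g j

/-- `C n`: the total size of the data items which, in the move-to-front list just before request
`n` is served, stand in front of the item asked for by request `n`. (It can be infinite if that
item has never been requested before.) -/
noncomputable def C (F : CacheFlows M D P) (n : ℤ) (ω : Ω) : ENNReal :=
  ∑' d : {d : D // InFront (fun j => F.R j ω) n d (F.R n ω)}, ENNReal.ofReal (F.size d)

/-- The popularity `ℙ[R₀ = item k i | I₀ = k]`. -/
noncomputable def popularity (F : CacheFlows M D P) (k : Fin M) (i : ℕ) : ℝ :=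
  (cond P {ω | F.I 0 ω = k}).real {ω | F.R 0 ω = F.item k i}

/-- The miss probability `ℙ[C₀ > x | I₀ = k]` of flow `k` for a cache of size `x`. -/
noncomputable def missProb (F : CacheFlows M D P) (k : Fin M) (x : ℝ) : ℝ :=
  (cond P {ω | F.I 0 ω = k}).real {ω | ENNReal.ofReal x < F.C 0 ω}

end CacheFlows

/-- The smallest exponent `min_k α_k`. -/
noncomputable def minExponent {M : ℕ} (α : Fin M → ℝ) : ℝ := ⨅ k, α k

open Classical in
/-- The set of the flows with the smallest exponent. -/
noncomputable def minFlows {M : ℕ} (α : Fin M → ℝ) : Finset (Fin M) :=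
  Finset.univ.filter fun k => α k = minExponent α

/-- `γ₁ = Γ(1 - 1/α̃₁) ∑_{k ∈ S₁} s_k (c_k ν_k)^{1/α̃₁}`. -/
noncomputable def gammaOne {M : ℕ} (α c ν s : Fin M → ℝ) : ℝ :=
  Real.Gamma (1 - 1 / minExponent α) *
    ∑ k ∈ minFlows α, s k * (c k * ν k) ^ (1 / minExponent α)

/-! Fix a flow `k` and look at the last `n` requests before request `0`. Let `W n` be the total size
of the distinct items among them, and let `T n` be the probability that request `0` comes from flow
`k` and its item is not among them. If the item is absent, every item of the window stands in front
of it, so `C 0 ≥ W n`; if it is present, everything in front of it lies in the window, so `C 0 ≤ W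
n`. Hence `ℙ[I 0 = k, C 0 > x]` lies between `T n - ℙ[W n ≤ x]` and `T n + ℙ[W n > x]` for every `n`
(`missProb_bounds`).

Both `T n = ∑ p i (1 - p i)^n` and the mean `m n` of `W n` are sums over power laws. After rescaling
the index by `n^(1/α)` they become Gamma integrals: `T n` is of order `n^(-(1 - 1/α k))`, while `m n
~ γ₁ n^(1/α̃₁)`, because flows with larger exponents contribute lower powers of `n`.

`W n` concentrates around `m n`: the events that an item occurs in the window are negatively
dependent (`integral_seenProd_le`), so Chernoff bounds hold as for independent indicators. With `n =
⌊(t x)^α̃₁⌋` the mean is about `γ₁ t x`, and the error is exponentially small in `x` when `t` is on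
the correct side of `1/γ₁`. Letting `t → 1/γ₁` gives the limit (`tendsto_of_chernoff_squeeze`). -/

open scoped Topology

/-! ### Rescaled sums as integrals of step functions -/

/-- The integral of a step function with steps of width `1 / N` is a scaled sum. -/
theorem hasSum_integral_step {h : ℕ → ℝ} {N : ℝ} (hN : 0 < N)
    (hint : IntegrableOn (fun u : ℝ => h ⌊N * u⌋₊) (Set.Ici 0)) :
    HasSum (fun i => N⁻¹ * h i) (∫ u in Set.Ici (0 : ℝ), h ⌊N * u⌋₊) := by
  have key : ∀ (i : ℕ) (u : ℝ), u ∈ Set.Ico ((i : ℝ) / N) ((i + 1 : ℝ) / N) ↔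
      0 ≤ u ∧ ⌊N * u⌋₊ = i := by
    intro i u
    rw [Set.mem_Ico, div_le_iff₀ hN, lt_div_iff₀ hN, mul_comm u N]
    constructor
    · rintro ⟨h1, h2⟩
      have h0 : 0 ≤ N * u := le_trans (Nat.cast_nonneg i) h1
      exact ⟨nonneg_of_mul_nonneg_right h0 hN, (Nat.floor_eq_iff h0).2 ⟨h1, h2⟩⟩
    · rintro ⟨h1, h2⟩
      exact (Nat.floor_eq_iff (by positivity)).1 h2
  have hU : (⋃ i : ℕ, Set.Ico ((i : ℝ) / N) ((i + 1 : ℝ) / N)) = Set.Ici 0 := by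
    ext u
    simp only [Set.mem_iUnion, key, Set.mem_Ici]
    exact ⟨fun ⟨_, h0, _⟩ => h0, fun h0 => ⟨_, h0, rfl⟩⟩
  have hs := hasSum_integral_iUnion (μ := volume) (f := fun u : ℝ => h ⌊N * u⌋₊)
    (s := fun i : ℕ => Set.Ico ((i : ℝ) / N) ((i + 1 : ℝ) / N))
    (fun i => measurableSet_Ico)
    (fun i j hij => Set.disjoint_left.2 fun u hi hj =>
      hij (((key i u).1 hi).2.symm.trans ((key j u).1 hj).2)) (by rwa [hU])
  rw [hU] at hs
  refine hs.congr_fun fun i => ?_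
  rw [setIntegral_congr_fun measurableSet_Ico
    (g := fun _ => h i) (fun u hu => by simp only [((key i u).1 hu).2])]
  simp only [integral_const, measureReal_restrict_apply_univ, Real.volume_real_Ico, smul_eq_mul]
  rw [max_eq_left (by rw [← sub_div]; simp; positivity)]
  ring

theorem integrableOn_min_one_rpow {K α : ℝ} (hK : 0 ≤ K) (hα : 1 < α) :
    IntegrableOn (fun u : ℝ => min 1 (K * u ^ (-α))) (Set.Ioi 0) := by
  rw [← Set.Ioc_union_Ioi_eq_Ioi (zero_le_one (α := ℝ))]
  have hm : Measurable (fun u : ℝ => min 1 (K * u ^ (-α))) := by fun_prop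
  have hnn : ∀ u : ℝ, 0 < u → 0 ≤ min 1 (K * u ^ (-α)) := fun u hu =>
    le_min zero_le_one (mul_nonneg hK (Real.rpow_nonneg hu.le _))
  refine IntegrableOn.union ?_ ?_
  · refine Integrable.mono' (g := fun _ => (1 : ℝ)) (integrableOn_const (by simp))
      hm.aestronglyMeasurable ((ae_restrict_iff' measurableSet_Ioc).2 (.of_forall fun u hu => ?_))
    rw [Real.norm_of_nonneg (hnn u hu.1)]
    exact min_le_left _ _
  · refine Integrable.mono' ((integrableOn_Ioi_rpow_of_lt (a := -α) (by linarith)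
      zero_lt_one).const_mul K)
      hm.aestronglyMeasurable ((ae_restrict_iff' measurableSet_Ioi).2 (.of_forall fun u hu => ?_))
    rw [Real.norm_of_nonneg (hnn u (zero_lt_one.trans hu))]
    exact min_le_right _ _

/-- The rescaled sum is the integral of a step function in `u`, and dominated convergence applies
with majorant `min 1 (K * u ^ (-α))`: the `1` makes it integrable at zero, `α > 1` at infinity. -/
theorem tendsto_scaled_tsum {g : ℕ → ℕ → ℝ} {G : ℝ → ℝ} {K α : ℝ} (hα : 1 < α)
    (hb : ∀ n i : ℕ, |g n i| ≤ min 1 (n * (K / ((i : ℝ) + 1) ^ α))) (hK : 0 ≤ K)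
    (hlim : ∀ u : ℝ, 0 < u →
      Tendsto (fun n : ℕ => g n ⌊(n : ℝ) ^ (1 / α) * u⌋₊) atTop (𝓝 (G u))) :
    Tendsto (fun n : ℕ => ((n : ℝ) ^ (1 / α))⁻¹ * ∑' i, g n i) atTop
      (𝓝 (∫ u in Set.Ioi (0 : ℝ), G u)) := by
  have hbound : ∀ n : ℕ, n ≠ 0 → ∀ u ∈ Set.Ioi (0 : ℝ),
      ‖g n ⌊(n : ℝ) ^ (1 / α) * u⌋₊‖ ≤ min 1 (K * u ^ (-α)) := by
    intro n hn u hu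
    have hu : 0 < u := hu
    have hn' : (0 : ℝ) < n := by positivity
    refine (hb n _).trans (min_le_min_left _ ?_)
    have h1 : ((n : ℝ) ^ (1 / α) * u) ^ α = n * u ^ α := by
      rw [Real.mul_rpow (by positivity) hu.le, ← Real.rpow_mul hn'.le,
        one_div_mul_cancel (by positivity), Real.rpow_one]
    -- The shift `i + 1` in the power law is what makes the majorant valid for every `u > 0`, even
    -- where the floor is zero.
    have h2 : (n : ℝ) * u ^ α ≤ ((⌊(n : ℝ) ^ (1 / α) * u⌋₊ : ℝ) + 1) ^ α := by
      rw [← h1]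
      exact Real.rpow_le_rpow (by positivity) (Nat.lt_floor_add_one _).le (by positivity)
    calc (n : ℝ) * (K / ((⌊(n : ℝ) ^ (1 / α) * u⌋₊ : ℝ) + 1) ^ α)
        ≤ n * (K / (n * u ^ α)) := by gcongr
      _ = K * u ^ (-α) := by rw [Real.rpow_neg hu.le]; field_simp
  have hmeas : ∀ n : ℕ, Measurable (fun u : ℝ => g n ⌊(n : ℝ) ^ (1 / α) * u⌋₊) := fun n =>
    (measurable_from_nat (f := g n)).comp (Nat.measurable_floor.comp (measurable_const_mul _))
  have hint := integrableOn_min_one_rpow hK hα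
  have hsum : ∀ n : ℕ, n ≠ 0 → ((n : ℝ) ^ (1 / α))⁻¹ * ∑' i, g n i =
      ∫ u in Set.Ioi (0 : ℝ), g n ⌊(n : ℝ) ^ (1 / α) * u⌋₊ := by
    intro n hn
    have hs := hasSum_integral_step (h := g n) (N := (n : ℝ) ^ (1 / α)) (by positivity) (by
      rw [integrableOn_Ici_iff_integrableOn_Ioi]
      exact hint.mono' (hmeas n).aestronglyMeasurable
        ((ae_restrict_iff' measurableSet_Ioi).2 (Eventually.of_forall (hbound n hn))))
    rw [← tsum_mul_left, hs.tsum_eq, integral_Ici_eq_integral_Ioi]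
  refine Tendsto.congr' (f₁ := fun n : ℕ =>
    ∫ u in Set.Ioi (0 : ℝ), g n ⌊(n : ℝ) ^ (1 / α) * u⌋₊) ?_ ?_
  · filter_upwards [eventually_ne_atTop 0] with n hn using (hsum n hn).symm
  · refine tendsto_integral_filter_of_dominated_convergence _
      (Eventually.of_forall fun n => (hmeas n).aestronglyMeasurable) ?_ hint ?_
    · filter_upwards [eventually_ne_atTop 0] with n hn
      exact (ae_restrict_iff' measurableSet_Ioi).2 (Eventually.of_forall (hbound n hn))
    · exact (ae_restrict_iff' measurableSet_Ioi).2 (Eventually.of_forall hlim)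

/-! ### Gamma integrals -/

/-- The substitution `u = x ^ (-(1 / α))` turns this into Euler's integral. -/
theorem integral_rpow_neg_mul_exp {a α : ℝ} (ha : 0 < a) (hα : 1 < α) :
    ∫ u in Set.Ioi (0 : ℝ), a * u ^ (-α) * Real.exp (-(a * u ^ (-α))) =
      1 / α * a ^ (1 / α) * Real.Gamma (1 - 1 / α) := by
  have h0 : 0 < α := by linarith
  have hρ : 1 / α < 1 := by rw [div_lt_one h0]; exact hα
  rw [← integral_comp_rpow_Ioi (fun u : ℝ => a * u ^ (-α) * Real.exp (-(a * u ^ (-α))))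
    (p := -(1 / α)) (by simp; positivity)]
  have h1 : Set.EqOn (fun x : ℝ => (|-(1 / α)| * x ^ (-(1 / α) - 1)) •
      (a * (x ^ (-(1 / α))) ^ (-α) * Real.exp (-(a * (x ^ (-(1 / α))) ^ (-α)))))
      (fun x => (1 / α * a) * (x ^ ((1 - 1 / α) - 1) * Real.exp (-(a * x)))) (Set.Ioi 0) := by
    intro x hx
    have hx : 0 < x := hx
    have h2 : (x ^ (-(1 / α))) ^ (-α) = x := by
      rw [← Real.rpow_mul hx.le]; field_simp; simp
    have h3 : x ^ ((1 - 1 / α) - 1) = x ^ (-(1 / α) - 1) * x := by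
      rw [← Real.rpow_add_one hx.ne']; ring_nf
    simp only [h2, h3, smul_eq_mul, abs_neg, abs_of_pos (one_div_pos.2 h0)]
    ring
  rw [setIntegral_congr_fun measurableSet_Ioi h1, integral_const_mul,
    Real.integral_rpow_mul_exp_neg_mul_Ioi (by linarith) ha]
  rw [one_div a, Real.inv_rpow ha.le, ← Real.rpow_neg ha.le]
  have : a ^ (1 / α) = a * a ^ (-(1 - 1 / α)) := by
    conv_rhs => rw [← Real.rpow_one_add' ha.le (by ring_nf; positivity)]
    ring_nf
  rw [this]; ring

theorem one_sub_exp_neg_le_min {y : ℝ} : 1 - Real.exp (-y) ≤ min 1 y :=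
  le_min (by linarith [Real.exp_pos (-y)]) (by linarith [Real.add_one_le_exp (-y)])

theorem mul_exp_neg_le_min {y : ℝ} (hy : 0 ≤ y) : y * Real.exp (-y) ≤ min 1 y := by
  refine le_min ?_ (mul_le_of_le_one_right hy (Real.exp_le_one_iff.2 (by linarith)))
  rw [Real.exp_neg, ← div_eq_mul_inv, div_le_one (Real.exp_pos y)]
  linarith [Real.add_one_le_exp y]

theorem integral_one_sub_exp_rpow_neg {a α : ℝ} (ha : 0 < a) (hα : 1 < α) :
    ∫ u in Set.Ioi (0 : ℝ), (1 - Real.exp (-(a * u ^ (-α)))) =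
      a ^ (1 / α) * Real.Gamma (1 - 1 / α) := by
  have h0 : 0 < α := by linarith
  have hint := integrableOn_min_one_rpow ha.le hα
  have hy : ∀ u : ℝ, 0 ≤ u → 0 ≤ a * u ^ (-α) := fun u hu =>
    mul_nonneg ha.le (Real.rpow_nonneg hu _)
  have hnn : ∀ u : ℝ, 0 ≤ u → 0 ≤ 1 - Real.exp (-(a * u ^ (-α))) := fun u hu => by
    have := Real.exp_le_one_iff.2 (neg_nonpos.2 (hy u hu)); linarith
  have hA : IntegrableOn (fun u : ℝ => 1 - Real.exp (-(a * u ^ (-α)))) (Set.Ioi 0) := by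
    have hm : Measurable (fun u : ℝ => 1 - Real.exp (-(a * u ^ (-α)))) := by fun_prop
    refine hint.mono' hm.aestronglyMeasurable
      ((ae_restrict_iff' measurableSet_Ioi).2 (.of_forall fun u hu => ?_))
    rw [Real.norm_of_nonneg (hnn u (Set.mem_Ioi.1 hu).le)]
    exact one_sub_exp_neg_le_min
  have hB : IntegrableOn (fun u : ℝ => a * u ^ (-α) * Real.exp (-(a * u ^ (-α))))
      (Set.Ioi 0) := by
    have hm : Measurable (fun u : ℝ => a * u ^ (-α) * Real.exp (-(a * u ^ (-α)))) := by fun_prop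
    refine hint.mono' hm.aestronglyMeasurable
      ((ae_restrict_iff' measurableSet_Ioi).2 (.of_forall fun u hu => ?_))
    have := hy u (Set.mem_Ioi.1 hu).le
    rw [Real.norm_of_nonneg (by positivity)]
    exact mul_exp_neg_le_min this
  have hFle : ∀ u : ℝ, 0 ≤ u → u * (1 - Real.exp (-(a * u ^ (-α)))) ≤ u := fun u hu =>
    mul_le_of_le_one_right hu (one_sub_exp_neg_le_min.trans (min_le_left _ _))
  -- Integration by parts: `u * (1 - exp (-(a * u ^ (-α))))` vanishes at both ends, so this integral
  -- is `α` times the previous one.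
  have hparts := integral_Ioi_of_hasDerivAt_of_tendsto (a := 0) (m := 0)
    (f := fun u : ℝ => u * (1 - Real.exp (-(a * u ^ (-α)))))
    (f' := fun u => (1 - Real.exp (-(a * u ^ (-α)))) -
      α * (a * u ^ (-α) * Real.exp (-(a * u ^ (-α))))) ?_ ?_ (hA.sub (hB.const_mul α)) ?_
  · rw [integral_sub hA (hB.const_mul α), integral_const_mul,
      integral_rpow_neg_mul_exp ha hα] at hparts
    simp only [zero_mul, sub_zero] at hparts
    rw [sub_eq_zero.1 hparts]
    field_simp
  · refine tendsto_of_tendsto_of_tendsto_of_le_of_le' (g := fun _ => 0) (h := fun u => u)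
      (by simp) ?_ ?_ ?_
    · simp only [zero_mul]
      exact tendsto_id.mono_left nhdsWithin_le_nhds
    · filter_upwards [self_mem_nhdsWithin] with u hu using mul_nonneg hu (hnn u hu)
    · filter_upwards [self_mem_nhdsWithin] with u hu using hFle u hu
  · intro u hu
    have hu : 0 < u := hu
    have h1 := (((Real.hasDerivAt_rpow_const (x := u) (p := -α) (.inl hu.ne')).const_mul
      a).fun_neg.exp.const_sub 1)
    convert! (hasDerivAt_id' u).mul h1 using 1
    rw [Real.rpow_sub_one hu.ne']
    field_simp
    ring
  · refine tendsto_of_tendsto_of_tendsto_of_le_of_le' (g := fun _ => 0)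
      (h := fun u => a * u ^ (-(α - 1))) tendsto_const_nhds ?_ ?_ ?_
    · simpa using (tendsto_rpow_neg_atTop (by linarith : 0 < α - 1)).const_mul a
    · filter_upwards [eventually_ge_atTop 0] with u hu using mul_nonneg hu (hnn u hu)
    · filter_upwards [eventually_gt_atTop 0] with u hu
      calc u * (1 - Real.exp (-(a * u ^ (-α)))) ≤ u * (a * u ^ (-α)) := by
            gcongr; exact one_sub_exp_neg_le_min.trans (min_le_right _ _)
        _ = a * u ^ (-(α - 1)) := by
            rw [show -(α - 1) = -α + 1 by ring, Real.rpow_add_one hu.ne']; ring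

/-! ### Asymptotics of sums over a power law -/

section PowerLaw

variable {p : ℕ → ℝ} {a α : ℝ}

theorem exists_le_of_isEquivalent_rpow (ha : 0 < a)
    (h : p ~[atTop] fun i : ℕ => a / ((i : ℝ) + 1) ^ α) :
    ∃ K : ℝ, 0 ≤ K ∧ ∀ i, p i ≤ K / ((i : ℝ) + 1) ^ α := by
  have hne : ∀ i : ℕ, a / ((i : ℝ) + 1) ^ α ≠ 0 := fun i => by positivity
  have ht := (isEquivalent_iff_tendsto_one (.of_forall hne)).1 h
  obtain ⟨K, hK⟩ := ht.bddAbove_range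
  refine ⟨max K 0 * a, by positivity, fun i => ?_⟩
  have h1 : p i / (a / ((i : ℝ) + 1) ^ α) ≤ max K 0 :=
    (hK ⟨i, rfl⟩).trans (le_max_left _ _)
  rwa [div_le_iff₀ (by positivity), ← mul_div_assoc] at h1

theorem tendsto_natCast_mul_floor (ha : 0 < a) (hα : 1 < α)
    (h : p ~[atTop] fun i : ℕ => a / ((i : ℝ) + 1) ^ α) {u : ℝ} (hu : 0 < u) :
    Tendsto (fun n : ℕ => n * p ⌊(n : ℝ) ^ (1 / α) * u⌋₊) atTop (𝓝 (a * u ^ (-α))) := by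
  have h0 : 0 < α := by linarith
  have hN : Tendsto (fun n : ℕ => (n : ℝ) ^ (1 / α)) atTop atTop :=
    (tendsto_rpow_atTop (by positivity)).comp tendsto_natCast_atTop_atTop
  have hfl : Tendsto (fun n : ℕ => ⌊(n : ℝ) ^ (1 / α) * u⌋₊) atTop atTop :=
    tendsto_nat_floor_atTop.comp (hN.atTop_mul_const hu)
  have hE := h.comp_tendsto hfl
  have hlim : Tendsto (fun n : ℕ =>
      n * (a / ((⌊(n : ℝ) ^ (1 / α) * u⌋₊ : ℝ) + 1) ^ α)) atTop (𝓝 (a * u ^ (-α))) := by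
    have h1 : Tendsto (fun n : ℕ => ((⌊(n : ℝ) ^ (1 / α) * u⌋₊ : ℝ) + 1) / (n : ℝ) ^ (1 / α))
        atTop (𝓝 u) := by
      have h2 := ((tendsto_nat_floor_mul_div_atTop hu.le).comp hN).add
        (tendsto_inv_atTop_zero.comp hN)
      rw [add_zero] at h2
      refine h2.congr fun n => ?_
      simp only [Function.comp, mul_comm u, add_div, one_div]
    have h3 := (h1.rpow_const (p := -α) (.inl hu.ne')).const_mul a
    refine h3.congr' ?_
    filter_upwards [eventually_gt_atTop 0] with n hn
    have hn' : (0 : ℝ) < n := by positivity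
    rw [Real.rpow_neg (by positivity), Real.div_rpow (by positivity) (by positivity),
      ← Real.rpow_mul hn'.le, one_div_mul_cancel h0.ne', Real.rpow_one]
    field_simp
  refine ((IsEquivalent.refl (u := fun n : ℕ => (n : ℝ))).mul hE).symm.tendsto_nhds ?_
  exact hlim

theorem tendsto_one_sub_pow_floor (ha : 0 < a) (hα : 1 < α)
    (h : p ~[atTop] fun i : ℕ => a / ((i : ℝ) + 1) ^ α) {u : ℝ} (hu : 0 < u) :
    Tendsto (fun n : ℕ => (1 - p ⌊(n : ℝ) ^ (1 / α) * u⌋₊) ^ n) atTop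
      (𝓝 (Real.exp (-(a * u ^ (-α))))) := by
  have h1 := Real.tendsto_one_add_pow_exp_of_tendsto
    (g := fun n : ℕ => -p ⌊(n : ℝ) ^ (1 / α) * u⌋₊) (t := -(a * u ^ (-α)))
    (by simpa using (tendsto_natCast_mul_floor ha hα h hu).neg)
  simpa [sub_eq_add_neg] using h1

theorem one_sub_one_sub_pow_le {x : ℝ} (hx1 : x ≤ 1) (n : ℕ) :
    1 - (1 - x) ^ n ≤ min 1 (n * x) := by
  refine le_min (by linarith [pow_nonneg (sub_nonneg.2 hx1) n]) ?_
  have := one_add_mul_le_pow (a := -x) (by linarith) n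
  rw [← sub_eq_add_neg] at this
  linarith

theorem one_sub_one_sub_pow_nonneg {x : ℝ} (hx0 : 0 ≤ x) (hx1 : x ≤ 1) (n : ℕ) :
    0 ≤ 1 - (1 - x) ^ n := by
  have := pow_le_one₀ (n := n) (sub_nonneg.2 hx1) (by linarith)
  linarith

/-- By Bernoulli, `n * x ≤ (1 + x) ^ n`, and `(1 + x) * (1 - x) ≤ 1`. -/
theorem natCast_mul_one_sub_pow_le {x : ℝ} (hx0 : 0 ≤ x) (hx1 : x ≤ 1) (n : ℕ) :
    n * x * (1 - x) ^ n ≤ min 1 (n * x) := by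
  have hpow := pow_nonneg (sub_nonneg.2 hx1) n
  refine le_min ?_ (mul_le_of_le_one_right (by positivity)
    (pow_le_one₀ (sub_nonneg.2 hx1) (by linarith)))
  calc n * x * (1 - x) ^ n ≤ (1 + x) ^ n * (1 - x) ^ n := by
        gcongr
        linarith [one_add_mul_le_pow (a := x) (by linarith) n]
    _ = (1 - x ^ 2) ^ n := by rw [← mul_pow]; ring_nf
    _ ≤ 1 := pow_le_one₀ (by nlinarith) (by nlinarith)

/-- Expected number of distinct items among `n` draws from a power law. -/
theorem tendsto_tsum_one_sub_one_sub_pow (ha : 0 < a) (hα : 1 < α)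
    (hp0 : ∀ i, 0 ≤ p i) (hp1 : ∀ i, p i ≤ 1)
    (h : p ~[atTop] fun i : ℕ => a / ((i : ℝ) + 1) ^ α) :
    Tendsto (fun n : ℕ => ((n : ℝ) ^ (1 / α))⁻¹ * ∑' i, (1 - (1 - p i) ^ n)) atTop
      (𝓝 (a ^ (1 / α) * Real.Gamma (1 - 1 / α))) := by
  obtain ⟨K, hK0, hK⟩ := exists_le_of_isEquivalent_rpow ha h
  rw [← integral_one_sub_exp_rpow_neg ha hα]
  refine tendsto_scaled_tsum (g := fun n i => 1 - (1 - p i) ^ n) hα (fun n i => ?_) hK0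
    fun u hu => (tendsto_one_sub_pow_floor ha hα h hu).const_sub 1
  rw [abs_of_nonneg (one_sub_one_sub_pow_nonneg (hp0 i) (hp1 i) n)]
  exact (one_sub_one_sub_pow_le (hp1 i) n).trans
    (min_le_min_left _ (by gcongr; exact hK i))

/-- Probability that a draw from a power law differs from `n` previous draws. -/
theorem tendsto_tsum_mul_one_sub_pow (ha : 0 < a) (hα : 1 < α)
    (hp0 : ∀ i, 0 ≤ p i) (hp1 : ∀ i, p i ≤ 1)
    (h : p ~[atTop] fun i : ℕ => a / ((i : ℝ) + 1) ^ α) :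
    Tendsto (fun n : ℕ => (n : ℝ) ^ (1 - 1 / α) * ∑' i, p i * (1 - p i) ^ n) atTop
      (𝓝 (1 / α * a ^ (1 / α) * Real.Gamma (1 - 1 / α))) := by
  obtain ⟨K, hK0, hK⟩ := exists_le_of_isEquivalent_rpow ha h
  rw [← integral_rpow_neg_mul_exp ha hα]
  -- The extra factor `n` brings the terms to order one; it accounts for the normalisation `n ^ (1 -
  -- 1 / α)`.
  refine (tendsto_scaled_tsum (g := fun n i => n * p i * (1 - p i) ^ n) hα (fun n i => ?_) hK0
    fun u hu => (tendsto_natCast_mul_floor ha hα h hu).mul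
      (tendsto_one_sub_pow_floor ha hα h hu)).congr' ?_
  · rw [abs_of_nonneg (mul_nonneg (mul_nonneg n.cast_nonneg (hp0 i))
      (pow_nonneg (sub_nonneg.2 (hp1 i)) n))]
    exact (natCast_mul_one_sub_pow_le (hp0 i) (hp1 i) n).trans
      (min_le_min_left _ (by gcongr; exact hK i))
  · filter_upwards [eventually_gt_atTop 0] with n hn
    have hn' : (0 : ℝ) < n := by positivity
    simp_rw [mul_assoc]
    rw [tsum_mul_left, Real.rpow_sub hn', Real.rpow_one]
    field_simp

end PowerLaw

/-! ### Negative dependence and Chernoff bounds for the distinct items in a window -/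

/-- Weierstrass' product inequality: the `y i` share a sign, so the cross terms in the induction are
nonnegative. -/
theorem one_add_sum_le_prod_one_add {ι : Type*} (A : Finset ι) {y : ι → ℝ}
    (h1 : ∀ i ∈ A, -1 ≤ y i) (h2 : ∀ i ∈ A, ∀ j ∈ A, 0 ≤ y i * y j) :
    1 + ∑ i ∈ A, y i ≤ ∏ i ∈ A, (1 + y i) := by
  classical
  induction A using Finset.induction_on with
  | empty => simp
  | insert e A he ih =>
    rw [Finset.sum_insert he, Finset.prod_insert he]
    have ih' := ih (fun i hi => h1 i (Finset.mem_insert_of_mem hi))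
      (fun i hi j hj => h2 i (Finset.mem_insert_of_mem hi) j (Finset.mem_insert_of_mem hj))
    have h3 : 0 ≤ y e * ∑ i ∈ A, y i := by
      rw [Finset.mul_sum]
      exact Finset.sum_nonneg fun i hi =>
        h2 e (Finset.mem_insert_self e A) i (Finset.mem_insert_of_mem hi)
    have h4 := mul_le_mul_of_nonneg_left ih'
      (by linarith [h1 e (Finset.mem_insert_self e A)] : 0 ≤ 1 + y e)
    linarith

section Window

variable {D : Type*} {Ω : Type*}

open Classical in
/-- The product over `d ∈ A` of the weights `w d` of the items which occur among the first `n`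
draws. -/
noncomputable def seenProd (X : ℕ → Ω → D) (w : D → ℝ) (n : ℕ) (A : Finset D) (ω : Ω) : ℝ :=
  ∏ d ∈ A, if ∃ j < n, X j ω = d then w d else 1

open Classical in
/-- The total weight of the items of `A` which occur among the first `n` draws. -/
noncomputable def seenSum (X : ℕ → Ω → D) (s : D → ℝ) (n : ℕ) (A : Finset D) (ω : Ω) : ℝ :=
  ∑ d ∈ A, if ∃ j < n, X j ω = d then s d else 0

open Classical in
/-- The total weight of the distinct items among the first `n` draws. -/
noncomputable def windowSize (X : ℕ → Ω → D) (s : D → ℝ) (n : ℕ) (ω : Ω) : ℝ :=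
  ∑ d ∈ (Finset.range n).image (fun j => X j ω), s d

theorem exp_mul_seenSum (X : ℕ → Ω → D) (s : D → ℝ) (n : ℕ) (A : Finset D) (θ : ℝ) (ω : Ω) :
    Real.exp (θ * seenSum X s n A ω) = seenProd X (fun d => Real.exp (θ * s d)) n A ω := by
  rw [seenSum, seenProd, Finset.mul_sum, Real.exp_sum]
  refine Finset.prod_congr rfl fun d _ => ?_
  split_ifs <;> simp

theorem seenProd_nonneg {w : D → ℝ} (hw : ∀ d, 0 ≤ w d) (n : ℕ) (A : Finset D) (ω : Ω) :
    0 ≤ seenProd X w n A ω := by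
  refine Finset.prod_nonneg fun d _ => ?_
  split_ifs
  exacts [hw d, zero_le_one]

-- A new draw alters the product only if it hits some `e ∈ A`; the factor of `e` then equals `w e`
-- whatever happened before.
open Classical in
theorem seenProd_succ (X : ℕ → Ω → D) (w : D → ℝ) (n : ℕ) (A : Finset D) (ω : Ω) :
    seenProd X w (n + 1) A ω = seenProd X w n A ω +
      ∑ e ∈ A, (w e * seenProd X w n (A.erase e) ω - seenProd X w n A ω) *
        (if X n ω = e then 1 else 0) := by
  have hcongr : ∀ B : Finset D, X n ω ∉ B → seenProd X w (n + 1) B ω = seenProd X w n B ω := by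
    intro B hB
    refine Finset.prod_congr rfl fun d hd => ?_
    have : (∃ j < n + 1, X j ω = d) ↔ ∃ j < n, X j ω = d := by
      rw [Nat.exists_lt_succ_right]
      exact or_iff_left fun h => hB (h ▸ hd)
    simp only [this]
  by_cases h : X n ω ∈ A
  · have h1 : seenProd X w (n + 1) A ω = w (X n ω) * seenProd X w n (A.erase (X n ω)) ω := by
      rw [← hcongr _ (Finset.notMem_erase _ _), seenProd, ← Finset.mul_prod_erase _ _ h,
        if_pos ⟨n, n.lt_succ_self, rfl⟩, seenProd]
    rw [Finset.sum_eq_single_of_mem _ h (fun e _ he => by rw [if_neg he.symm, mul_zero]), h1]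
    simp
  · rw [hcongr A h, Finset.sum_eq_zero, add_zero]
    intro e he
    have : X n ω ≠ e := by rintro rfl; exact h he
    rw [if_neg this, mul_zero]

theorem seenSum_le_windowSize (X : ℕ → Ω → D) {s : D → ℝ} (hs : ∀ d, 0 ≤ s d) (n : ℕ)
    (A : Finset D) (ω : Ω) : seenSum X s n A ω ≤ windowSize X s n ω := by
  classical
  rw [seenSum, windowSize, ← Finset.sum_filter]
  refine Finset.sum_le_sum_of_subset_of_nonneg (fun d hd => ?_) fun d _ _ => hs d
  obtain ⟨j, hj, rfl⟩ := (Finset.mem_filter.1 hd).2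
  exact Finset.mem_image_of_mem _ (Finset.mem_range.2 hj)

open Classical in
theorem windowSize_eq_seenSum (X : ℕ → Ω → D) (s : D → ℝ) (n : ℕ) (ω : Ω) :
    windowSize X s n ω = seenSum X s n ((Finset.range n).image (fun j => X j ω)) ω := by
  refine Finset.sum_congr rfl fun d hd => ?_
  obtain ⟨j, hj, rfl⟩ := Finset.mem_image.1 hd
  rw [if_pos ⟨j, Finset.mem_range.1 hj, rfl⟩]

theorem monotone_seenSum (X : ℕ → Ω → D) {s : D → ℝ} (hs : ∀ d, 0 ≤ s d) (n : ℕ) (ω : Ω) :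
    Monotone fun A => seenSum X s n A ω := by
  intro A B h
  refine Finset.sum_le_sum_of_subset_of_nonneg h fun d _ _ => ?_
  split_ifs
  exacts [hs d, le_rfl]

variable [MeasurableSpace D] [Countable D] [DiscreteMeasurableSpace D] [MeasurableSpace Ω]
  {P : Measure Ω} {X : ℕ → Ω → D} {p : D → ℝ}

theorem measurableSet_seen (hX : ∀ j, Measurable (X j)) (n : ℕ) (d : D) :
    MeasurableSet {ω | ∃ j < n, X j ω = d} := by
  have : {ω | ∃ j < n, X j ω = d} = ⋃ j ∈ Finset.range n, X j ⁻¹' {d} := by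
    ext; simp
  rw [this]
  exact Finset.measurableSet_biUnion _ fun j _ => hX j (measurableSet_singleton d)

theorem measurable_seenProd (hX : ∀ j, Measurable (X j)) (w : D → ℝ) (n : ℕ) (A : Finset D) :
    Measurable (seenProd X w n A) := by
  classical
  exact Finset.measurable_fun_prod A fun d _ =>
    Measurable.ite (measurableSet_seen hX n d) measurable_const measurable_const

open Classical in
theorem integral_seenProd_mul_indicator (hX : ∀ j, Measurable (X j)) (hind : iIndepFun X P)
    (hp : ∀ j d, P.real {ω | X j ω = d} = p d) {w : D → ℝ} (n : ℕ) (A : Finset D)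
    (e : D) :
    ∫ ω, seenProd X w n A ω * (if X n ω = e then 1 else 0) ∂P =
      (∫ ω, seenProd X w n A ω ∂P) * p e := by
  have h1 := hind.indepFun_finset (Finset.range n) {n} (by simp) hX
  have hφ : Measurable fun v : Finset.range n → D =>
      ∏ d ∈ A, if ∃ j : Finset.range n, v j = d then w d else 1 := by
    refine Finset.measurable_fun_prod A fun d _ =>
      Measurable.ite ?_ measurable_const measurable_const
    simp only [Set.ofPred_exists]
    exact MeasurableSet.iUnion fun j =>
      (measurable_pi_apply (X := fun _ : Finset.range n => D) j) (measurableSet_singleton d)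
  have hψ : Measurable fun v : ({n} : Finset ℕ) → D =>
      if v ⟨n, Finset.mem_singleton_self n⟩ = e then (1 : ℝ) else 0 :=
    Measurable.ite ((measurable_pi_apply (X := fun _ : ({n} : Finset ℕ) => D) _)
      (measurableSet_singleton e)) measurable_const measurable_const
  have h2 := h1.comp hφ hψ
  have h3 : ((fun v : Finset.range n → D =>
      ∏ d ∈ A, if ∃ j : Finset.range n, v j = d then w d else 1) ∘
      fun a (i : Finset.range n) => X i a) = seenProd X w n A := by
    ext ω
    simp [seenProd]
  rw [h3] at h2
  have hset : MeasurableSet {ω | X n ω = e} := hX n (measurableSet_singleton e)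
  have h4 : ∫ ω, (if X n ω = e then (1 : ℝ) else 0) ∂P = p e := by
    rw [← hp n e, ← integral_indicator_one hset]
    rfl
  rw [← h4]
  exact h2.integral_fun_mul_eq_mul_integral (measurable_seenProd hX w n A).aestronglyMeasurable
    (Measurable.ite hset measurable_const measurable_const).aestronglyMeasurable

variable [IsProbabilityMeasure P]

theorem integrable_seenProd (hX : ∀ j, Measurable (X j)) {w : D → ℝ} (hw : ∀ d, 0 ≤ w d)
    (n : ℕ) (A : Finset D) : Integrable (seenProd X w n A) P := by
  refine Integrable.of_bound (measurable_seenProd hX w n A).aestronglyMeasurable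
    (∏ d ∈ A, (1 + w d)) (.of_forall fun ω => ?_)
  rw [Real.norm_of_nonneg (seenProd_nonneg hw n A ω)]
  refine Finset.prod_le_prod (fun d _ => ?_) fun d _ => ?_
  · split_ifs
    exacts [hw d, zero_le_one]
  · have := hw d
    split_ifs <;> linarith

theorem sum_le_one_of_prob (hX : ∀ j, Measurable (X j))
    (hp : ∀ j d, P.real {ω | X j ω = d} = p d) (A : Finset D) : ∑ d ∈ A, p d ≤ 1 := by
  have h : ∑ d ∈ A, p d = P.real (⋃ d ∈ A, {ω | X 0 ω = d}) := by
    rw [measureReal_biUnion_finset (f := fun d => {ω | X 0 ω = d}) (fun d _ e _ hde => Set.disjoint_left.2 fun ω hd he =>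
      hde (hd.symm.trans he)) fun d _ => hX 0 (measurableSet_singleton d)]
    exact Finset.sum_congr rfl fun d _ => (hp 0 d).symm
  rw [h]
  exact measureReal_le_one

open Classical in
/-- The indicators of the events that an item occurs among the first `n` draws are negatively
dependent. -/
theorem integral_seenProd_le (hX : ∀ j, Measurable (X j)) (hind : iIndepFun X P)
    (hp : ∀ j d, P.real {ω | X j ω = d} = p d) {a : D → ℝ} (ha : ∀ d, -1 < a d)
    (haa : ∀ d e, 0 ≤ a d * a e) (n : ℕ) (A : Finset D) :
    ∫ ω, seenProd X (fun d => 1 + a d) n A ω ∂P ≤ ∏ d ∈ A, (1 + a d * (1 - (1 - p d) ^ n)) := by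
  have hw : ∀ d, 0 ≤ 1 + a d := fun d => by linarith [ha d]
  have hp0 : ∀ d, 0 ≤ p d := fun d => hp 0 d ▸ measureReal_nonneg
  have hp1 : ∀ d, p d ≤ 1 := fun d => hp 0 d ▸ measureReal_le_one
  induction n generalizing A with
  | zero => simp [seenProd]
  | succ n ih =>
    set g : D → ℝ := fun d => 1 + a d * (1 - (1 - p d) ^ n) with hg
    have hpow : ∀ d, 0 ≤ (1 - p d) ^ n := fun d => pow_nonneg (sub_nonneg.2 (hp1 d)) n
    have hpow1 : ∀ d, (1 - p d) ^ n ≤ 1 := fun d =>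
      pow_le_one₀ (sub_nonneg.2 (hp1 d)) (by linarith [hp0 d])
    have hgpos : ∀ d, 0 < g d := by
      intro d
      simp only [hg]
      rcases le_total 0 (a d) with h | h
      · have := mul_nonneg h (sub_nonneg.2 (hpow1 d))
        linarith
      · have := mul_nonneg_of_nonpos_of_nonpos h (neg_nonpos.2 (hpow d))
        linarith [ha d]
    -- Relative growth of the factor `g d` from `n` to `n + 1` draws. The induction step reduces to
    -- comparing `1 + ∑ y` with `∏ (1 + y)`.
    set y : D → ℝ := fun d => p d * a d * (1 - p d) ^ n / g d with hy
    have hgy : ∀ d, g d * (1 + y d) = 1 + a d * (1 - (1 - p d) ^ (n + 1)) := by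
      intro d
      have : g d * (1 + y d) = g d + p d * a d * (1 - p d) ^ n := by
        simp only [hy]
        field_simp [(hgpos d).ne']
      rw [this, pow_succ]
      simp only [hg]
      ring
    have hwg : ∀ d, p d * (1 + a d) = g d * (p d + y d) := by
      intro d
      have : g d * (p d + y d) = p d * g d + p d * a d * (1 - p d) ^ n := by
        simp only [hy]
        field_simp [(hgpos d).ne']
      rw [this]
      simp only [hg]
      ring
    have hy1 : ∀ d, -1 ≤ y d := by
      intro d
      have h1 : 0 ≤ p d + y d := by
        have h2 : 0 ≤ g d * (p d + y d) := hwg d ▸ mul_nonneg (hp0 d) (hw d)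
        exact nonneg_of_mul_nonneg_right h2 (hgpos d)
      linarith [hp1 d]
    -- Each `y d` is a nonnegative multiple of `a d`, so the common sign of the `a d` passes to the
    -- `y d`.
    have hyy : ∀ d e, 0 ≤ y d * y e := by
      intro d e
      have : y d * y e = (a d * a e) * ((p d * (1 - p d) ^ n / g d) *
          (p e * (1 - p e) ^ n / g e)) := by simp only [hy]; ring
      rw [this]
      exact mul_nonneg (haa d e) (mul_nonneg
        (div_nonneg (mul_nonneg (hp0 d) (hpow d)) (hgpos d).le)
        (div_nonneg (mul_nonneg (hp0 e) (hpow e)) (hgpos e).le))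
    set w : D → ℝ := fun d => 1 + a d with hwdef
    -- Conditioning on the last draw removes the item drawn from `A`; this is why the induction runs
    -- over all `A`.
    have hrec : ∫ ω, seenProd X w (n + 1) A ω ∂P =
        (1 - ∑ e ∈ A, p e) * ∫ ω, seenProd X w n A ω ∂P +
          ∑ e ∈ A, p e * (1 + a e) * ∫ ω, seenProd X w n (A.erase e) ω ∂P := by
      have hI : ∀ B, Integrable (seenProd X w n B) P := integrable_seenProd hX hw n
      have hII : ∀ B e, Integrable (fun ω => seenProd X w n B ω *
          (if X n ω = e then 1 else 0)) P := by
        intro B e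
        refine (hI B).mul_bdd (c := 1) (Measurable.ite (hX n (measurableSet_singleton e))
          measurable_const measurable_const).aestronglyMeasurable (.of_forall fun ω => ?_)
        split_ifs <;> simp
      have hS : ∀ e ∈ A, Integrable (fun ω => w e * (seenProd X w n (A.erase e) ω *
          (if X n ω = e then 1 else 0)) - seenProd X w n A ω * (if X n ω = e then 1 else 0)) P :=
        fun e _ => ((hII _ e).const_mul _).sub (hII _ e)
      have hpt : ∀ ω, seenProd X w (n + 1) A ω = seenProd X w n A ω +
          ∑ e ∈ A, (w e * (seenProd X w n (A.erase e) ω * (if X n ω = e then 1 else 0)) -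
            seenProd X w n A ω * (if X n ω = e then 1 else 0)) := by
        intro ω
        rw [seenProd_succ]
        simp only [sub_mul, mul_assoc]
      simp_rw [hpt]
      rw [integral_add (hI A) (integrable_finsetSum _ hS), integral_finsetSum _ hS, sub_mul,
        one_mul, Finset.sum_mul, sub_add, ← Finset.sum_sub_distrib, sub_eq_add_neg,
        ← Finset.sum_neg_distrib]
      congr 1
      refine Finset.sum_congr rfl fun e _ => ?_
      rw [integral_sub ((hII _ e).const_mul _) (hII _ e), integral_const_mul,
        integral_seenProd_mul_indicator hX hind hp, integral_seenProd_mul_indicator hX hind hp]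
      ring
    rw [hrec]
    calc (1 - ∑ e ∈ A, p e) * ∫ ω, seenProd X w n A ω ∂P +
          ∑ e ∈ A, p e * (1 + a e) * ∫ ω, seenProd X w n (A.erase e) ω ∂P
        ≤ (1 - ∑ e ∈ A, p e) * ∏ d ∈ A, g d +
          ∑ e ∈ A, p e * (1 + a e) * ∏ d ∈ A.erase e, g d := by
          refine add_le_add (mul_le_mul_of_nonneg_left (ih A)
            (sub_nonneg.2 (sum_le_one_of_prob hX hp A)))
            (Finset.sum_le_sum fun e _ => mul_le_mul_of_nonneg_left (ih _)
              (mul_nonneg (hp0 e) (hw e)))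
      _ = (∏ d ∈ A, g d) * (1 + ∑ e ∈ A, y e) := by
          have : ∀ e ∈ A, p e * (1 + a e) * ∏ d ∈ A.erase e, g d =
              (∏ d ∈ A, g d) * p e + (∏ d ∈ A, g d) * y e := by
            intro e he
            rw [hwg, ← Finset.mul_prod_erase A g he]
            ring
          rw [Finset.sum_congr rfl this, Finset.sum_add_distrib, ← Finset.mul_sum,
            ← Finset.mul_sum]
          ring
      _ ≤ (∏ d ∈ A, g d) * ∏ e ∈ A, (1 + y e) :=
          mul_le_mul_of_nonneg_left (one_add_sum_le_prod_one_add A (fun i _ => hy1 i)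
            fun i _ j _ => hyy i j) (Finset.prod_nonneg fun d _ => (hgpos d).le)
      _ = ∏ d ∈ A, (1 + a d * (1 - (1 - p d) ^ (n + 1))) := by
          rw [← Finset.prod_mul_distrib]
          exact Finset.prod_congr rfl fun d _ => hgy d

/-- Negative dependence with `a d = exp (θ * s d) - 1`, whose sign is that of `θ`. Then `1 + z ≤ exp
z`, and `exp u - 1 ≤ u + u ^ 2` for `|u| ≤ 1` with `u = θ * s d`. -/
theorem mgf_seenSum_le (hX : ∀ j, Measurable (X j)) (hind : iIndepFun X P)
    (hp : ∀ j d, P.real {ω | X j ω = d} = p d) {s : D → ℝ} {σ θ : ℝ} (hs0 : ∀ d, 0 ≤ s d)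
    (hsσ : ∀ d, s d ≤ σ) (hθ : |θ| * σ ≤ 1) (n : ℕ) (A : Finset D) :
    mgf (seenSum X s n A) P θ ≤
      Real.exp ((θ + θ ^ 2 * σ) * ∑ d ∈ A, s d * (1 - (1 - p d) ^ n)) := by
  have hp0 : ∀ d, 0 ≤ p d := fun d => hp 0 d ▸ measureReal_nonneg
  have hp1 : ∀ d, p d ≤ 1 := fun d => hp 0 d ▸ measureReal_le_one
  have h1 := integral_seenProd_le hX hind hp (a := fun d => Real.exp (θ * s d) - 1)
    (fun d => by linarith [Real.exp_pos (θ * s d)]) (fun d e => ?_) n A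
  · have h2 : mgf (seenSum X s n A) P θ =
        ∫ ω, seenProd X (fun d => 1 + (Real.exp (θ * s d) - 1)) n A ω ∂P := by
      simp only [mgf, exp_mul_seenSum, add_sub_cancel]
    rw [h2]
    refine h1.trans ?_
    rw [Finset.mul_sum, Real.exp_sum]
    refine Finset.prod_le_prod (fun d _ => ?_) fun d _ => ?_
    · have h3 := one_sub_one_sub_pow_nonneg (hp0 d) (hp1 d) n
      have h4 := (one_sub_one_sub_pow_le (hp1 d) n).trans (min_le_left _ _)
      nlinarith [Real.exp_pos (θ * s d)]
    · have h3 := one_sub_one_sub_pow_nonneg (hp0 d) (hp1 d) n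
      have h5 : |θ * s d| ≤ 1 := by
        rw [abs_mul, abs_of_nonneg (hs0 d)]
        exact (mul_le_mul_of_nonneg_left (hsσ d) (abs_nonneg θ)).trans hθ
      have h6 : Real.exp (θ * s d) - 1 ≤ (θ + θ ^ 2 * σ) * s d := by
        have h7 := (abs_le.1 (Real.abs_exp_sub_one_sub_id_le h5)).2
        have h8 : (θ * s d) ^ 2 ≤ θ ^ 2 * σ * s d := by
          have := mul_le_mul_of_nonneg_left (mul_le_mul_of_nonneg_right (hsσ d) (hs0 d))
            (sq_nonneg θ)
          linarith
        linarith
      have h9 := mul_le_mul_of_nonneg_right h6 h3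
      have h10 := Real.add_one_le_exp ((θ + θ ^ 2 * σ) * (s d * (1 - (1 - p d) ^ n)))
      linarith
  · rcases le_total 0 θ with h | h
    · exact mul_nonneg (sub_nonneg.2 (Real.one_le_exp (mul_nonneg h (hs0 d))))
        (sub_nonneg.2 (Real.one_le_exp (mul_nonneg h (hs0 e))))
    · exact mul_nonneg_of_nonpos_of_nonpos
        (sub_nonpos.2 (Real.exp_le_one_iff.2 (mul_nonpos_of_nonpos_of_nonneg h (hs0 d))))
        (sub_nonpos.2 (Real.exp_le_one_iff.2 (mul_nonpos_of_nonpos_of_nonneg h (hs0 e))))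

theorem integrable_exp_mul_seenSum (hX : ∀ j, Measurable (X j)) (s : D → ℝ) (n : ℕ)
    (A : Finset D) (θ : ℝ) : Integrable (fun ω => Real.exp (θ * seenSum X s n A ω)) P := by
  simp_rw [exp_mul_seenSum]
  exact integrable_seenProd hX (fun d => (Real.exp_pos _).le) n A

/-- Chernoff bound for the upper tail of the total size of the distinct items in a window. -/
theorem measureReal_lt_windowSize_le (hX : ∀ j, Measurable (X j)) (hind : iIndepFun X P)
    (hp : ∀ j d, P.real {ω | X j ω = d} = p d) {s : D → ℝ} {σ θ m : ℝ} (hs0 : ∀ d, 0 ≤ s d)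
    (hsσ : ∀ d, s d ≤ σ) (hσ : 0 ≤ σ) (hθ0 : 0 ≤ θ) (hθ : θ * σ ≤ 1) {n : ℕ}
    (hm : HasSum (fun d => s d * (1 - (1 - p d) ^ n)) m) (x : ℝ) :
    P.real {ω | x < windowSize X s n ω} ≤ Real.exp (-θ * x + (θ + θ ^ 2 * σ) * m) := by
  have hp0 : ∀ d, 0 ≤ p d := fun d => hp 0 d ▸ measureReal_nonneg
  have hp1 : ∀ d, p d ≤ 1 := fun d => hp 0 d ▸ measureReal_le_one
  have hA : ∀ A, P.real {ω | x < seenSum X s n A ω} ≤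
      Real.exp (-θ * x + (θ + θ ^ 2 * σ) * m) := by
    intro A
    calc P.real {ω | x < seenSum X s n A ω} ≤ P.real {ω | x ≤ seenSum X s n A ω} :=
          measureReal_mono fun ω (h : x < _) => h.le
      _ ≤ Real.exp (-θ * x) * mgf (seenSum X s n A) P θ :=
          measure_ge_le_exp_mul_mgf x hθ0 (integrable_exp_mul_seenSum hX s n A θ)
      _ ≤ Real.exp (-θ * x) *
          Real.exp ((θ + θ ^ 2 * σ) * ∑ d ∈ A, s d * (1 - (1 - p d) ^ n)) := by
          gcongr
          exact mgf_seenSum_le hX hind hp hs0 hsσ (by rwa [abs_of_nonneg hθ0]) n A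
      _ ≤ Real.exp (-θ * x) * Real.exp ((θ + θ ^ 2 * σ) * m) := by
          gcongr
          exact sum_le_hasSum A (fun d _ => mul_nonneg (hs0 d)
            (one_sub_one_sub_pow_nonneg (hp0 d) (hp1 d) n)) hm
      _ = Real.exp (-θ * x + (θ + θ ^ 2 * σ) * m) := (Real.exp_add _ _).symm
  -- The set of items in the window is random. The events for deterministic finite sets `A` increase
  -- with `A`, so the uniform bound passes to their union.
  have hU : {ω | x < windowSize X s n ω} ⊆ ⋃ A : Finset D, {ω | x < seenSum X s n A ω} := by
    intro ω hω
    rw [Set.mem_ofPred_eq, windowSize_eq_seenSum] at hω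
    exact Set.mem_iUnion.2 ⟨_, hω⟩
  have hmono : Monotone fun A : Finset D => {ω | x < seenSum X s n A ω} :=
    fun A B h ω (hω : x < _) => lt_of_lt_of_le hω (monotone_seenSum X hs0 n ω h)
  have hP : P {ω | x < windowSize X s n ω} ≤
      ENNReal.ofReal (Real.exp (-θ * x + (θ + θ ^ 2 * σ) * m)) := by
    refine (measure_mono hU).trans ?_
    rw [hmono.directed_le.measure_iUnion]
    refine iSup_le fun A => ?_
    rw [← ofReal_measureReal]
    exact ENNReal.ofReal_le_ofReal (hA A)
  exact ENNReal.toReal_le_of_le_ofReal (Real.exp_pos _).le hP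

/-- Chernoff bound for the lower tail of the total size of the distinct items in a window. -/
theorem measureReal_windowSize_le_le (hX : ∀ j, Measurable (X j)) (hind : iIndepFun X P)
    (hp : ∀ j d, P.real {ω | X j ω = d} = p d) {s : D → ℝ} {σ θ m : ℝ} (hs0 : ∀ d, 0 ≤ s d)
    (hsσ : ∀ d, s d ≤ σ) (hθ0 : 0 ≤ θ) (hθ : θ * σ ≤ 1) {n : ℕ}
    (hm : HasSum (fun d => s d * (1 - (1 - p d) ^ n)) m) (x : ℝ) :
    P.real {ω | windowSize X s n ω ≤ x} ≤ Real.exp (θ * x + (-θ + θ ^ 2 * σ) * m) := by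
  have hA : ∀ A, P.real {ω | windowSize X s n ω ≤ x} ≤
      Real.exp (θ * x + (-θ + θ ^ 2 * σ) * ∑ d ∈ A, s d * (1 - (1 - p d) ^ n)) := by
    intro A
    calc P.real {ω | windowSize X s n ω ≤ x} ≤ P.real {ω | seenSum X s n A ω ≤ x} :=
          measureReal_mono fun ω (h : _ ≤ x) => (seenSum_le_windowSize X hs0 n A ω).trans h
      _ ≤ Real.exp (-(-θ) * x) * mgf (seenSum X s n A) P (-θ) :=
          measure_le_le_exp_mul_mgf x (by linarith) (integrable_exp_mul_seenSum hX s n A _)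
      _ ≤ Real.exp (-(-θ) * x) *
          Real.exp ((-θ + (-θ) ^ 2 * σ) * ∑ d ∈ A, s d * (1 - (1 - p d) ^ n)) := by
          gcongr
          exact mgf_seenSum_le hX hind hp hs0 hsσ (by rwa [abs_neg, abs_of_nonneg hθ0]) n A
      _ = Real.exp (θ * x + (-θ + θ ^ 2 * σ) * ∑ d ∈ A, s d * (1 - (1 - p d) ^ n)) := by
          rw [neg_neg, neg_sq, ← Real.exp_add]
  -- The coefficient `-θ + θ ^ 2 * σ` is nonpositive, so the bound at a finite `A` is weaker than
  -- the one with `m`; the limit over `A` is needed.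
  have hm' : Tendsto (fun A : Finset D => ∑ d ∈ A, s d * (1 - (1 - p d) ^ n)) atTop (𝓝 m) := by
    simpa [HasSum] using hm
  exact ge_of_tendsto' ((Real.continuous_exp.tendsto _).comp
    ((hm'.const_mul _).const_add _)) hA

end Window

/-! ### Squeezing with window length `⌊(t * x) ^ a⌋₊` -/

theorem tendsto_floor_rpow {t a : ℝ} (ht : 0 < t) (ha : 0 < a) :
    Tendsto (fun x : ℝ => ⌊(t * x) ^ a⌋₊) atTop atTop :=
  tendsto_nat_floor_atTop.comp ((tendsto_rpow_atTop ha).comp (tendsto_id.const_mul_atTop ht))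

theorem tendsto_floor_rpow_div {t a b : ℝ} (ht : 0 < t) (ha : 0 < a) :
    Tendsto (fun x : ℝ => (⌊(t * x) ^ a⌋₊ : ℝ) ^ (b / a) / x ^ b) atTop (𝓝 (t ^ b)) := by
  have h1 : Tendsto (fun x : ℝ => (⌊(t * x) ^ a⌋₊ : ℝ) / (t * x) ^ a) atTop (𝓝 1) :=
    (tendsto_nat_floor_div_atTop (R := ℝ)).comp
      ((tendsto_rpow_atTop ha).comp (tendsto_id.const_mul_atTop ht))
  have h2 := (h1.rpow_const (p := b / a) (.inl one_ne_zero)).const_mul (t ^ b)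
  rw [Real.one_rpow, mul_one] at h2
  refine h2.congr' ?_
  filter_upwards [eventually_gt_atTop 0] with x hx
  have htx : 0 < t * x := mul_pos ht hx
  rw [Real.div_rpow (by positivity) (by positivity), ← Real.rpow_mul htx.le,
    mul_div_cancel₀ b ha.ne', Real.mul_rpow (z := b) ht.le hx.le]
  have := Real.rpow_pos_of_pos ht b
  generalize (⌊(t * x) ^ a⌋₊ : ℝ) ^ (b / a) = y
  field_simp

theorem tendsto_rpow_mul_exp_neg_mul_const {b κ : ℝ} (hκ : 0 < κ) :
    Tendsto (fun x : ℝ => Real.exp (-κ * x) * x ^ b) atTop (𝓝 0) := by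
  simpa [mul_comm] using tendsto_rpow_mul_exp_neg_mul_atTop_nhds_zero b κ hκ

/-- A function which is squeezed by values of `T` up to exponential Chernoff terms. -/
theorem tendsto_of_chernoff_squeeze {f : ℝ → ℝ} {T m : ℕ → ℝ} {a β γ σ c₀ ν : ℝ}
    (ha : 0 < a) (hγ : 0 < γ) (hσ : 0 < σ) (hν : 0 < ν)
    (hT : Tendsto (fun n : ℕ => (n : ℝ) ^ β * T n) atTop (𝓝 c₀))
    (hm : Tendsto (fun n : ℕ => ((n : ℝ) ^ (1 / a))⁻¹ * m n) atTop (𝓝 γ))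
    (hU : ∀ (n : ℕ) (x θ : ℝ), 0 ≤ x → 0 ≤ θ → θ * σ ≤ 1 →
      f x ≤ ν⁻¹ * (T n + Real.exp (-θ * x + (θ + θ ^ 2 * σ) * m n)))
    (hL : ∀ (n : ℕ) (x θ : ℝ), 0 ≤ x → 0 ≤ θ → θ * σ ≤ 1 →
      ν⁻¹ * (T n - Real.exp (θ * x + (-θ + θ ^ 2 * σ) * m n)) ≤ f x) :
    Tendsto (fun x => f x * x ^ (a * β)) atTop (𝓝 (ν⁻¹ * c₀ * γ ^ (a * β))) := by
  have hmt : ∀ t : ℝ, 0 < t →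
      Tendsto (fun x : ℝ => m ⌊(t * x) ^ a⌋₊ / x) atTop (𝓝 (γ * t)) := by
    intro t ht
    have h1 := (hm.comp (tendsto_floor_rpow ht ha)).mul
      (tendsto_floor_rpow_div (b := 1) ht ha)
    rw [Real.rpow_one] at h1
    refine h1.congr' ?_
    filter_upwards [(tendsto_floor_rpow ht ha).eventually_gt_atTop 0] with x hx
    have hx' : (0 : ℝ) < (⌊(t * x) ^ a⌋₊ : ℝ) := by exact_mod_cast hx
    have := Real.rpow_pos_of_pos hx' (1 / a)
    simp only [Function.comp, Real.rpow_one]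
    field_simp
  have hTt : ∀ t : ℝ, 0 < t →
      Tendsto (fun x : ℝ => T ⌊(t * x) ^ a⌋₊ * x ^ (a * β)) atTop
        (𝓝 (c₀ * t ^ (-(a * β)))) := by
    intro t ht
    have h0 : t ^ (a * β) ≠ 0 := (Real.rpow_pos_of_pos ht _).ne'
    have h1 := (hT.comp (tendsto_floor_rpow ht ha)).mul
      ((tendsto_floor_rpow_div (b := a * β) ht ha).inv₀ h0)
    rw [← Real.rpow_neg ht.le] at h1
    refine h1.congr' ?_
    filter_upwards [(tendsto_floor_rpow ht ha).eventually_gt_atTop 0,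
      eventually_gt_atTop 0] with x hx hx0
    have hx' : (0 : ℝ) < (⌊(t * x) ^ a⌋₊ : ℝ) := by exact_mod_cast hx
    have := Real.rpow_pos_of_pos hx' β
    simp only [Function.comp, mul_div_cancel_left₀ β ha.ne']
    field_simp
  have hcont : Tendsto (fun t : ℝ => ν⁻¹ * (c₀ * t ^ (-(a * β)))) (𝓝 γ⁻¹)
      (𝓝 (ν⁻¹ * c₀ * γ ^ (a * β))) := by
    have h1 := (((Real.continuousAt_rpow_const γ⁻¹ (-(a * β))
      (.inl (inv_pos.2 hγ).ne')).tendsto.const_mul c₀).const_mul ν⁻¹)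
    rwa [Real.inv_rpow hγ.le, Real.rpow_neg hγ.le, inv_inv, ← mul_assoc] at h1
  have hupper : ∀ t : ℝ, 0 < t → t < γ⁻¹ → ∀ v, ν⁻¹ * (c₀ * t ^ (-(a * β))) < v →
      ∀ᶠ x in atTop, f x * x ^ (a * β) < v := by
    intro t ht0 ht v hv
    have hγt : γ * t < 1 := by rw [mul_comm]; exact (lt_inv_mul_iff₀' hγ).1 (by simpa using ht)
    -- Eventually `m n < r * x` with `r < 1`. The choice `θ = (1 - r) / σ` satisfies `θ * σ ≤ 1` for
    -- every such `r` and gives the exponent `-((1 - r) ^ 3 / σ) * x`.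
    obtain ⟨r, hr, hr1⟩ := exists_between hγt
    have hr0 : 0 < r := (mul_pos hγ ht0).trans hr
    have h1r : 0 < 1 - r := sub_pos.2 hr1
    have hlim := ((hTt t ht0).add (tendsto_rpow_mul_exp_neg_mul_const (b := a * β)
      (by positivity : 0 < (1 - r) ^ 3 / σ))).const_mul ν⁻¹
    rw [add_zero] at hlim
    filter_upwards [hlim.eventually_lt_const hv, (hmt t ht0).eventually_lt_const hr,
      eventually_gt_atTop 0] with x hxv hxm hx0
    refine lt_of_le_of_lt ?_ hxv
    rw [div_lt_iff₀ hx0] at hxm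
    have hpos := Real.rpow_pos_of_pos hx0 (a * β)
    have h2 := hU ⌊(t * x) ^ a⌋₊ x ((1 - r) / σ) hx0.le (by positivity)
      (by rw [div_mul_cancel₀ _ hσ.ne']; linarith)
    have h3 : -((1 - r) / σ) * x + ((1 - r) / σ + ((1 - r) / σ) ^ 2 * σ) * m ⌊(t * x) ^ a⌋₊ ≤
        -((1 - r) ^ 3 / σ) * x := by
      calc _ ≤ -((1 - r) / σ) * x + ((1 - r) / σ + ((1 - r) / σ) ^ 2 * σ) * (r * x) := by gcongr
        _ = -((1 - r) ^ 3 / σ) * x := by field_simp; ring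
    calc f x * x ^ (a * β) ≤ ν⁻¹ * (T ⌊(t * x) ^ a⌋₊ + Real.exp (-((1 - r) ^ 3 / σ) * x)) *
          x ^ (a * β) := by
          refine mul_le_mul_of_nonneg_right (h2.trans ?_) hpos.le
          gcongr
      _ = _ := by ring
  have hlower : ∀ t : ℝ, γ⁻¹ < t → ∀ v, v < ν⁻¹ * (c₀ * t ^ (-(a * β))) →
      ∀ᶠ x in atTop, v < f x * x ^ (a * β) := by
    intro t ht v hv
    have ht0 : 0 < t := (inv_pos.2 hγ).trans ht
    have hγt : 1 < γ * t := by rwa [inv_lt_iff_one_lt_mul₀' hγ] at ht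
    -- Eventually `m n > r * x` with `r > 1`. Here `θ = (r - 1) / (2 * r * σ)` minimises `θ + (-θ +
    -- θ ^ 2 * σ) * r`.
    obtain ⟨r, hr1, hr⟩ := exists_between hγt
    have h1r : 0 < r - 1 := sub_pos.2 hr1
    have hr0 : 0 < r := zero_lt_one.trans hr1
    have hlim := ((hTt t ht0).sub (tendsto_rpow_mul_exp_neg_mul_const (b := a * β)
      (by positivity : 0 < (r - 1) ^ 2 / (4 * r * σ)))).const_mul ν⁻¹
    rw [sub_zero] at hlim
    filter_upwards [hlim.eventually_const_lt hv, (hmt t ht0).eventually_const_lt hr,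
      eventually_gt_atTop 0] with x hxv hxm hx0
    refine lt_of_lt_of_le hxv ?_
    rw [lt_div_iff₀ hx0] at hxm
    have hpos := Real.rpow_pos_of_pos hx0 (a * β)
    have hθσ : (r - 1) / (2 * r * σ) * σ = (r - 1) / (2 * r) := by field_simp
    have hθσ1 : (r - 1) / (2 * r) ≤ 1 := by rw [div_le_one (by positivity)]; linarith
    have hθ0 : 0 ≤ (r - 1) / (2 * r * σ) := by positivity
    have h2 := hL ⌊(t * x) ^ a⌋₊ x ((r - 1) / (2 * r * σ)) hx0.le hθ0 (by rwa [hθσ])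
    have h3 : (r - 1) / (2 * r * σ) * x + (-((r - 1) / (2 * r * σ)) +
        ((r - 1) / (2 * r * σ)) ^ 2 * σ) * m ⌊(t * x) ^ a⌋₊ ≤
        -((r - 1) ^ 2 / (4 * r * σ)) * x := by
      have h4 : -((r - 1) / (2 * r * σ)) + ((r - 1) / (2 * r * σ)) ^ 2 * σ ≤ 0 := by
        have : ((r - 1) / (2 * r * σ)) ^ 2 * σ =
            (r - 1) / (2 * r * σ) * ((r - 1) / (2 * r)) := by rw [sq, mul_assoc, hθσ]
        rw [this]
        linarith [mul_le_of_le_one_right hθ0 hθσ1]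
      calc _ ≤ (r - 1) / (2 * r * σ) * x + (-((r - 1) / (2 * r * σ)) +
            ((r - 1) / (2 * r * σ)) ^ 2 * σ) * (r * x) := by
              linarith [mul_le_mul_of_nonpos_left hxm.le h4]
        _ = -((r - 1) ^ 2 / (4 * r * σ)) * x := by field_simp; ring
    calc _ = ν⁻¹ * (T ⌊(t * x) ^ a⌋₊ - Real.exp (-((r - 1) ^ 2 / (4 * r * σ)) * x)) *
          x ^ (a * β) := by ring
      _ ≤ f x * x ^ (a * β) := by
          refine mul_le_mul_of_nonneg_right (le_trans ?_ h2) hpos.le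
          gcongr
  -- Both one-sided bounds are continuous in `t`, so `t` can be taken close enough to `γ⁻¹` on the
  -- required side.
  refine tendsto_order.2 ⟨fun v hv => ?_, fun v hv => ?_⟩
  · obtain ⟨t, ht, hvt⟩ := (((hcont.mono_left nhdsWithin_le_nhds).eventually_const_lt hv).and
      (self_mem_nhdsWithin (s := Set.Ioi γ⁻¹))).exists
    exact hlower t hvt v ht
  · obtain ⟨t, ⟨ht, hvt⟩, ht0⟩ := (((hcont.mono_left nhdsWithin_le_nhds).eventually_lt_const
      hv).and (self_mem_nhdsWithin (s := Set.Iio γ⁻¹))).and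
      (nhdsWithin_le_nhds (lt_mem_nhds (inv_pos.2 hγ))) |>.exists
    exact hupper t ht0 hvt v ht

/-! ### The move-to-front list and the window of past requests -/

namespace CacheFlows

variable {M : ℕ} {D : Type*} [MeasurableSpace D] {Ω : Type*} [MeasurableSpace Ω] {P : Measure Ω}
  (F : CacheFlows M D P)

/-- The requests before request `0`, the most recent one first. -/
def past (j : ℕ) (ω : Ω) : D := F.R (-(j + 1 : ℕ)) ω

/-- The event that the item asked for by request `0` is not among the `n` previous requests. -/
def unseen (n : ℕ) : Set Ω := {ω | ∀ j < n, F.past j ω ≠ F.R 0 ω}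

/-- The data items which belong to some flow. -/
def listed : Set D := {d | ∃ k i, F.item k i = d}

open Classical in
/-- The sizes of the data items which belong to some flow. -/
noncomputable def listedSize (d : D) : ℝ := if d ∈ F.listed then F.size d else 0

/-- The probability that a request asks for the item `d`. -/
noncomputable def prob (d : D) : ℝ := P.real {ω | F.R 0 ω = d}

theorem item_mem_listed (k : Fin M) (i : ℕ) : F.item k i ∈ F.listed := ⟨k, i, rfl⟩

theorem ae_listed : ∀ᵐ ω ∂P, ∀ n, F.R n ω ∈ F.listed :=
  ae_all_iff.2 fun n => (F.request_mem n).mono fun ω ⟨i, hi⟩ => ⟨F.I n ω, i, hi.symm⟩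

/-- An item in front was requested after the last request for `R 0`, which already lies in the
window. -/
theorem C_le_of_not_mem_unseen {n : ℕ} {ω : Ω} (hω : ∀ n, F.R n ω ∈ F.listed)
    (hs : ∀ d ∈ F.listed, 0 ≤ F.size d) (h : ω ∉ F.unseen n) :
    F.C 0 ω ≤ ENNReal.ofReal (windowSize F.past F.listedSize n ω) := by
  classical
  simp only [unseen, Set.mem_ofPred_eq, not_forall, not_not, exists_prop] at h
  obtain ⟨j, hj, hjR⟩ := h
  have hV : ∀ d, InFront (fun j => F.R j ω) 0 d (F.R 0 ω) →
      d ∈ (Finset.range n).image (fun j => F.past j ω) := by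
    rintro d ⟨l, hl, rfl, hne⟩
    have hlj : -((j + 1 : ℕ) : ℤ) < l := by
      by_contra hc
      exact hne _ (not_lt.1 hc) (by omega) hjR
    refine Finset.mem_image.2 ⟨(-l - 1).toNat, Finset.mem_range.2 (by omega), ?_⟩
    simp only [past]
    congr 1
    push_cast
    omega
  -- Sizes of unlisted items are arbitrary; `listedSize` replaces them by zero so that size bounds
  -- hold for all items, and the requests in `ω` never meet them.
  have hsize : ∀ d ∈ (Finset.range n).image (fun j => F.past j ω),
      F.listedSize d = F.size d ∧ 0 ≤ F.size d := by
    intro d hd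
    obtain ⟨i, -, rfl⟩ := Finset.mem_image.1 hd
    exact ⟨if_pos (hω _), hs _ (hω _)⟩
  rw [windowSize, Finset.sum_congr rfl fun d hd => (hsize d hd).1,
    ENNReal.ofReal_sum_of_nonneg fun d hd => (hsize d hd).2,
    ← Finset.tsum_subtype' _ fun d => ENNReal.ofReal (F.size d)]
  exact ENNReal.tsum_mono_subtype (fun d => ENNReal.ofReal (F.size d)) fun d hd => hV d hd

theorem windowSize_le_C_of_mem_unseen {n : ℕ} {ω : Ω} (hω : ∀ n, F.R n ω ∈ F.listed)
    (hs : ∀ d ∈ F.listed, 0 ≤ F.size d) (h : ω ∈ F.unseen n) :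
    ENNReal.ofReal (windowSize F.past F.listedSize n ω) ≤ F.C 0 ω := by
  classical
  have hsize : ∀ d ∈ (Finset.range n).image (fun j => F.past j ω),
      F.listedSize d = F.size d ∧ 0 ≤ F.size d := by
    intro d hd
    obtain ⟨i, -, rfl⟩ := Finset.mem_image.1 hd
    exact ⟨if_pos (hω _), hs _ (hω _)⟩
  have hV : ∀ d ∈ (Finset.range n).image (fun j => F.past j ω),
      InFront (fun j => F.R j ω) 0 d (F.R 0 ω) := by
    intro d hd
    obtain ⟨j, hj, rfl⟩ := Finset.mem_image.1 hd
    rw [Finset.mem_range] at hj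
    refine ⟨-(j + 1 : ℕ), by omega, rfl, fun i hi hi0 hR => ?_⟩
    refine h (-i - 1).toNat (by omega) ?_
    rw [← hR, past]
    congr 1
    push_cast
    omega
  rw [windowSize, Finset.sum_congr rfl fun d hd => (hsize d hd).1,
    ENNReal.ofReal_sum_of_nonneg fun d hd => (hsize d hd).2,
    ← Finset.tsum_subtype' _ fun d => ENNReal.ofReal (F.size d)]
  exact ENNReal.tsum_mono_subtype (fun d => ENNReal.ofReal (F.size d)) fun d hd => hV d hd

theorem measurable_past (j : ℕ) : Measurable (F.past j) := F.measurable_R _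

theorem iIndepFun_R : iIndepFun F.R P :=
  F.indep.comp (fun _ => Prod.snd) fun _ => measurable_snd

theorem iIndepFun_past : iIndepFun F.past P :=
  F.iIndepFun_R.precomp (g := fun j : ℕ => -((j + 1 : ℕ) : ℤ)) fun i j h => by
    simp only at h; omega

theorem ae_I_eq_of_R_eq_item (hF : F.NonOverlapping) (n : ℤ) :
    ∀ᵐ ω ∂P, ∀ k i, F.R n ω = F.item k i → F.I n ω = k := by
  filter_upwards [F.request_mem n] with ω ⟨j, hj⟩ k i hi
  by_contra hne
  exact hF _ _ hne j i (hj.symm.trans hi)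

theorem cond_real (k : Fin M) (A : Set Ω) :
    (cond P {ω | F.I 0 ω = k}).real A =
      (P.real {ω | F.I 0 ω = k})⁻¹ * P.real ({ω | F.I 0 ω = k} ∩ A) := by
  have hk : MeasurableSet {ω | F.I 0 ω = k} := F.measurable_I 0 (measurableSet_singleton k)
  rw [measureReal_def, cond_apply hk, ENNReal.toReal_mul, ENNReal.toReal_inv]
  rfl

/-- Since flows do not overlap, asking for `item k i` almost surely forces the flow to be `k`. -/
theorem prob_item [IsProbabilityMeasure P] (hF : F.NonOverlapping) (k : Fin M) (i : ℕ)
    (hk : P.real {ω | F.I 0 ω = k} ≠ 0) :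
    F.prob (F.item k i) = P.real {ω | F.I 0 ω = k} * F.popularity k i := by
  rw [popularity, F.cond_real k, mul_inv_cancel_left₀ hk]
  refine measureReal_congr ?_
  filter_upwards [F.ae_I_eq_of_R_eq_item hF 0] with ω hω
  exact propext ⟨fun h => ⟨hω k i h, h⟩, fun h => h.2⟩

variable [Countable D] [DiscreteMeasurableSpace D]

theorem measureReal_R (n : ℤ) (d : D) : P.real {ω | F.R n ω = d} = F.prob d := by
  have h := (F.ident n).comp measurable_snd
  rw [prob, measureReal_def, measureReal_def]
  congr 1
  exact h.measure_mem_eq (measurableSet_singleton d)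

theorem measureReal_R_ne [IsProbabilityMeasure P] (n : ℤ) (d : D) :
    P.real {ω | F.R n ω ≠ d} = 1 - F.prob d := by
  rw [← F.measureReal_R n d]
  exact probReal_compl_eq_one_sub (F.measurable_R n (measurableSet_singleton d))

theorem measureReal_unseen_item [IsProbabilityMeasure P] (n : ℕ) (d : D) :
    P.real {ω | F.R 0 ω = d ∧ ω ∈ F.unseen n} = F.prob d * (1 - F.prob d) ^ n := by
  set Y : ℕ → Ω → D := fun j => F.R (-(j : ℤ)) with hY
  have hind : iIndepFun Y P := F.iIndepFun_R.precomp (g := fun j : ℕ => -(j : ℤ)) fun i j h => by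
    simp only at h; omega
  -- Request `0` and its past form one independent sequence: index `0` must hit `d`, the next `n`
  -- must avoid it.
  set S : ℕ → Set D := fun j => if j = 0 then {d} else {d}ᶜ with hS
  have h := hind.measure_inter_preimage_eq_mul (Finset.range (n + 1)) (sets := S)
    fun i _ => MeasurableSet.of_discrete
  have hset : {ω | F.R 0 ω = d ∧ ω ∈ F.unseen n} =
      ⋂ j ∈ Finset.range (n + 1), Y j ⁻¹' S j := by
    ext ω
    simp only [Set.mem_ofPred_eq, Set.mem_iInter, Finset.mem_range, unseen, Set.mem_preimage]
    constructor
    · rintro ⟨rfl, h2⟩ (_ | j) hj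
      · simp [hS, hY]
      · simpa [hS, hY, past] using h2 j (by omega)
    · intro h
      have h0 : F.R 0 ω = d := by simpa [hS, hY] using h 0 (by omega)
      refine ⟨h0, fun j hj => ?_⟩
      simpa [hS, hY, past, h0] using h (j + 1) (by omega)
  have hne : ∀ j : ℕ, (P (Y (j + 1) ⁻¹' S (j + 1))).toReal = 1 - F.prob d :=
    fun j => F.measureReal_R_ne _ d
  have heq : (P (Y 0 ⁻¹' S 0)).toReal = F.prob d := F.measureReal_R _ d
  rw [hset, measureReal_def, h, ENNReal.toReal_prod, Finset.prod_range_succ', heq, mul_comm]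
  simp only [hne, Finset.prod_const, Finset.card_range]

theorem hasSum_unseen_flow [IsProbabilityMeasure P] (hF : F.NonOverlapping) (k : Fin M) (n : ℕ) :
    HasSum (fun i => F.prob (F.item k i) * (1 - F.prob (F.item k i)) ^ n)
      (P.real ({ω | F.I 0 ω = k} ∩ F.unseen n)) := by
  have hU : P.real ({ω | F.I 0 ω = k} ∩ F.unseen n) =
      P.real (⋃ i, {ω | F.R 0 ω = F.item k i ∧ ω ∈ F.unseen n}) := by
    refine measureReal_congr ?_
    filter_upwards [F.ae_I_eq_of_R_eq_item hF 0, F.request_mem 0] with ω hω hmem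
    refine propext ⟨fun h => ?_, fun h => ?_⟩
    · obtain ⟨i, hi⟩ := hmem
      obtain ⟨rfl, h2⟩ := h
      exact Set.mem_iUnion.2 ⟨i, hi, h2⟩
    · obtain ⟨i, hi, h2⟩ := Set.mem_iUnion.1 h
      exact ⟨hω k i hi, h2⟩
  have hmeas : MeasurableSet (F.unseen n) := by
    have : F.unseen n = ⋂ j, ⋂ (_ : j < n), {ω | F.past j ω = F.R 0 ω}ᶜ := by
      ext; simp [unseen]
    rw [this]
    exact MeasurableSet.iInter fun j => MeasurableSet.iInter fun _ =>
      (((F.measurable_past j).prodMk (F.measurable_R 0))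
        (MeasurableSet.of_discrete (s := Set.diagonal D))).compl
  have hsum := measure_iUnion (μ := P)
    (f := fun i => {ω | F.R 0 ω = F.item k i ∧ ω ∈ F.unseen n})
    (fun i j hij => Set.disjoint_left.2 fun ω hi hj =>
      hij (F.item_injective k (hi.1.symm.trans hj.1)))
    (fun i => (F.measurable_R 0 (measurableSet_singleton _)).inter hmeas)
  have hs := ENNReal.hasSum_toReal (hsum ▸ measure_ne_top P _)
  rw [← ENNReal.tsum_toReal_eq fun i => measure_ne_top P _, ← hsum] at hs
  rw [hU]
  simpa only [← measureReal_def, F.measureReal_unseen_item] using hs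

end CacheFlows

/-! ### Asymptotics of the miss probability -/

namespace CacheFlows

variable {M : ℕ} {D : Type*} [MeasurableSpace D] {Ω : Type*} [MeasurableSpace Ω] {P : Measure Ω}
  (F : CacheFlows M D P)

/-- The expected total size of the distinct items among `n` requests. -/
noncomputable def expectedSize (s : Fin M → ℝ) (n : ℕ) : ℝ :=
  ∑ k, s k * ∑' i, (1 - (1 - F.prob (F.item k i)) ^ n)

theorem prob_nonneg (d : D) : 0 ≤ F.prob d := measureReal_nonneg

theorem prob_le_one [IsProbabilityMeasure P] (d : D) : F.prob d ≤ 1 := measureReal_le_one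

theorem prob_item_isEquivalent [IsProbabilityMeasure P] (hF : F.NonOverlapping) {k : Fin M}
    {α c ν : ℝ} (hν : 0 < ν) (hI : P.real {ω | F.I 0 ω = k} = ν)
    (hq : F.popularity k ~[atTop] fun i : ℕ => c / ((i : ℝ) + 1) ^ α) :
    (fun i => F.prob (F.item k i)) ~[atTop] fun i : ℕ => (c * ν) / ((i : ℝ) + 1) ^ α := by
  have h := (IsEquivalent.refl (u := fun _ : ℕ => ν) (l := atTop)).mul hq
  refine (h.congr_left (.of_forall fun i => ?_)).congr_right (.of_forall fun i => ?_)
  · rw [F.prob_item hF k i (hI ▸ hν.ne'), hI]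
    rfl
  · simp only [Pi.mul_apply]
    ring

/-- Flow `k` contributes at order `n ^ (1 / α k)`, so only the flows of smallest exponent survive
the normalisation. -/
theorem tendsto_expectedSize [IsProbabilityMeasure P] (hF : F.NonOverlapping) {α c ν : Fin M → ℝ} (s : Fin M → ℝ)
    (hα : ∀ k, 1 < α k) (hc : ∀ k, 0 < c k) (hν : ∀ k, 0 < ν k)
    (hI : ∀ k, P.real {ω | F.I 0 ω = k} = ν k)
    (hq : ∀ k, F.popularity k ~[atTop] fun i : ℕ => c k / ((i : ℝ) + 1) ^ α k) :
    Tendsto (fun n : ℕ => ((n : ℝ) ^ (1 / minExponent α))⁻¹ * F.expectedSize s n) atTop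
      (𝓝 (gammaOne α c ν s)) := by
  have hmin : ∀ k, minExponent α ≤ α k := fun k => ciInf_le (Set.finite_range α).bddBelow k
  have hk : ∀ k, Tendsto (fun n : ℕ => ((n : ℝ) ^ (1 / minExponent α))⁻¹ *
      (s k * ∑' i, (1 - (1 - F.prob (F.item k i)) ^ n))) atTop
      (𝓝 (if α k = minExponent α then
        Real.Gamma (1 - 1 / minExponent α) * (s k * (c k * ν k) ^ (1 / minExponent α)) else 0)) := by
    intro k
    have h1 := (tendsto_tsum_one_sub_one_sub_pow (mul_pos (hc k) (hν k)) (hα k)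
      (fun i => F.prob_nonneg (F.item k i)) (fun i => F.prob_le_one (F.item k i))
      (F.prob_item_isEquivalent hF (hν k) (hI k) (hq k))).const_mul (s k)
    split_ifs with h
    · rw [← h]
      convert h1 using 1
      · ext n; ring
      · congr 1; ring
    · have hlt : minExponent α < α k := lt_of_le_of_ne (hmin k) (Ne.symm h)
      have hpos : 0 < minExponent α := by
        have : Nonempty (Fin M) := ⟨k⟩
        obtain ⟨g, hg⟩ := exists_eq_ciInf_of_finite (f := α)
        exact (zero_lt_one.trans (hα g)).trans_eq hg
      have h2 : Tendsto (fun n : ℕ => (n : ℝ) ^ (-(1 / minExponent α - 1 / α k))) atTop (𝓝 0) :=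
        (tendsto_rpow_neg_atTop (sub_pos.2 (one_div_lt_one_div_of_lt hpos hlt))).comp
          tendsto_natCast_atTop_atTop
      have h3 := h2.mul h1
      rw [zero_mul] at h3
      refine h3.congr' ?_
      filter_upwards [eventually_gt_atTop 0] with n hn
      have hn' : (0 : ℝ) < n := by positivity
      rw [neg_sub, Real.rpow_sub hn']
      have := Real.rpow_pos_of_pos hn' (1 / α k)
      field_simp
  have h := tendsto_finsetSum Finset.univ fun k _ => hk k
  rw [← Finset.sum_filter, ← Finset.mul_sum] at h
  refine (h.congr fun n => ?_).trans_eq ?_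
  · rw [expectedSize, Finset.mul_sum]
  · rfl

variable [Countable D] [DiscreteMeasurableSpace D] [IsProbabilityMeasure P]

theorem hasSum_listedSize (hF : F.NonOverlapping) {s : Fin M → ℝ} (hs : ∀ k, 0 ≤ s k)
    (hsize : ∀ k i, F.size (F.item k i) = s k) (n : ℕ) :
    HasSum (fun d => F.listedSize d * (1 - (1 - F.prob d) ^ n)) (F.expectedSize s n) := by
  have hinj : Function.Injective fun x : Fin M × ℕ => F.item x.1 x.2 := by
    rintro ⟨k, i⟩ ⟨g, j⟩ h
    obtain rfl : k = g := by
      by_contra hne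
      exact hF k g hne i j h
    exact congrArg _ (F.item_injective k h)
  rw [← hinj.hasSum_iff (fun d hd => ?_)]
  · have hfun : ((fun d => F.listedSize d * (1 - (1 - F.prob d) ^ n)) ∘
        fun x : Fin M × ℕ => F.item x.1 x.2) =
        fun x : Fin M × ℕ => s x.1 * (1 - (1 - F.prob (F.item x.1 x.2)) ^ n) := by
      ext x
      simp only [Function.comp, listedSize, if_pos (F.item_mem_listed _ _), hsize]
    have hnn : ∀ d, 0 ≤ 1 - (1 - F.prob d) ^ n := fun d =>
      one_sub_one_sub_pow_nonneg (F.prob_nonneg d) (F.prob_le_one d) n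
    have hk : ∀ k, Summable fun i => s k * (1 - (1 - F.prob (F.item k i)) ^ n) := by
      intro k
      -- For `n = 0` the event is just `I 0 = k`, which gives summability of the probabilities; `1 -
      -- (1 - p) ^ n ≤ n * p` does the rest.
      have h0 := (F.hasSum_unseen_flow hF k 0).summable
      simp only [pow_zero, mul_one] at h0
      exact ((h0.mul_left (n : ℝ)).of_nonneg_of_le (fun i => hnn _) fun i =>
        (one_sub_one_sub_pow_le (F.prob_le_one _) n).trans (min_le_right _ _)).mul_left _
    have hsum : Summable fun x : Fin M × ℕ => s x.1 * (1 - (1 - F.prob (F.item x.1 x.2)) ^ n) :=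
      (summable_prod_of_nonneg fun x => mul_nonneg (hs _) (hnn _)).2
        ⟨hk, (hasSum_fintype _).summable⟩
    rw [hfun]
    convert hsum.hasSum using 1
    rw [hsum.tsum_prod, tsum_fintype, expectedSize]
    simp only [tsum_mul_left]
  · have : d ∉ F.listed := fun ⟨k, i, h⟩ => hd ⟨(k, i), h⟩
    rw [listedSize, if_neg this, zero_mul]

/-- Splitting on whether the item of request `0` occurs in the window leaves only the Chernoff tails
as errors. The sum of all `s k` serves as the uniform size bound. -/
theorem missProb_bounds (hF : F.NonOverlapping) {ν s : Fin M → ℝ} (hs : ∀ k, 0 ≤ s k)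
    (hν : ∀ k, 0 < ν k) (hI : ∀ k, P.real {ω | F.I 0 ω = k} = ν k)
    (hsize : ∀ k i, F.size (F.item k i) = s k) (k : Fin M) (n : ℕ) {x θ : ℝ} (hx : 0 ≤ x)
    (hθ0 : 0 ≤ θ) (hθ : θ * ∑ k, s k ≤ 1) :
    F.missProb k x ≤ (ν k)⁻¹ * (∑' i, F.prob (F.item k i) * (1 - F.prob (F.item k i)) ^ n +
      Real.exp (-θ * x + (θ + θ ^ 2 * ∑ k, s k) * F.expectedSize s n)) ∧
    (ν k)⁻¹ * (∑' i, F.prob (F.item k i) * (1 - F.prob (F.item k i)) ^ n -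
      Real.exp (θ * x + (-θ + θ ^ 2 * ∑ k, s k) * F.expectedSize s n)) ≤ F.missProb k x := by
  have hσ : 0 ≤ ∑ k, s k := Finset.sum_nonneg fun k _ => hs k
  have hls : ∀ d, 0 ≤ F.listedSize d ∧ F.listedSize d ≤ ∑ k, s k := by
    intro d
    rw [listedSize]
    split_ifs with h
    · obtain ⟨g, i, rfl⟩ := h
      rw [hsize]
      exact ⟨hs g, Finset.single_le_sum (fun k _ => hs k) (Finset.mem_univ g)⟩
    · exact ⟨le_rfl, hσ⟩
  have hpast : ∀ j d, P.real {ω | F.past j ω = d} = F.prob d := fun j d => F.measureReal_R _ d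
  have hsum := F.hasSum_listedSize hF hs hsize n
  have hup := measureReal_lt_windowSize_le F.measurable_past F.iIndepFun_past hpast
    (fun d => (hls d).1) (fun d => (hls d).2) hσ hθ0 hθ hsum x
  have hlo := measureReal_windowSize_le_le F.measurable_past F.iIndepFun_past hpast
    (fun d => (hls d).1) (fun d => (hls d).2) hθ0 hθ hsum x
  have hsz : ∀ d ∈ F.listed, 0 ≤ F.size d := by
    rintro _ ⟨g, i, rfl⟩
    rw [hsize]
    exact hs g
  have hν' : 0 ≤ (ν k)⁻¹ := (inv_pos.2 (hν k)).le
  rw [missProb, cond_real, hI, (F.hasSum_unseen_flow hF k n).tsum_eq]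
  constructor
  · refine mul_le_mul_of_nonneg_left (le_trans ?_ (add_le_add_right hup _)) hν'
    refine le_trans (ENNReal.toReal_mono (measure_ne_top _ _) (measure_mono_ae ?_)) (measureReal_union_le _ _)
    filter_upwards [F.ae_listed] with ω hω ⟨hk, hC⟩
    by_cases hu : ω ∈ F.unseen n
    · exact Or.inl ⟨hk, hu⟩
    · refine Or.inr ?_
      exact (ENNReal.ofReal_lt_ofReal_iff_of_nonneg hx).1
        (lt_of_lt_of_le hC (F.C_le_of_not_mem_unseen hω hsz hu))
  · refine mul_le_mul_of_nonneg_left (sub_le_iff_le_add.2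
      (le_trans ?_ (add_le_add_right hlo _))) hν'
    refine le_trans (ENNReal.toReal_mono (measure_ne_top _ _) (measure_mono_ae ?_)) (measureReal_union_le _ _)
    filter_upwards [F.ae_listed] with ω hω ⟨hk, hu⟩
    rcases le_or_gt (windowSize F.past F.listedSize n ω) x with h | h
    · exact Or.inr h
    · exact Or.inl ⟨hk, lt_of_lt_of_le ((ENNReal.ofReal_lt_ofReal_iff_of_nonneg hx).2 h)
        (F.windowSize_le_C_of_mem_unseen hω hsz hu)⟩

/-- The squeeze with `a = minExponent α` and `β = 1 - 1 / α k` covers both kinds of flows: for `α k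
= minExponent α` the exponent `a * β` is `minExponent α - 1`. -/
theorem missProb_isEquivalent (hF : F.NonOverlapping) {α c ν s : Fin M → ℝ}
    (hα : ∀ k, 1 < α k) (hc : ∀ k, 0 < c k) (hs : ∀ k, 0 < s k) (hν : ∀ k, 0 < ν k)
    (hI : ∀ k, P.real {ω | F.I 0 ω = k} = ν k)
    (hq : ∀ k, F.popularity k ~[atTop] fun i : ℕ => c k / ((i : ℝ) + 1) ^ α k)
    (hsize : ∀ k i, F.size (F.item k i) = s k) (k : Fin M) :
    F.missProb k ~[atTop] fun x : ℝ =>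
      Real.Gamma (2 - 1 / α k) / (α k - 1) *
        (gammaOne α c ν s ^ (minExponent α - minExponent α / α k) /
          (ν k * c k) ^ (1 - 1 / α k)) *
        (c k / x ^ (minExponent α - minExponent α / α k)) := by
  have : Nonempty (Fin M) := ⟨k⟩
  obtain ⟨g, hg⟩ := exists_eq_ciInf_of_finite (f := α)
  have hg : α g = minExponent α := hg
  have hmin : 1 < minExponent α := hg ▸ hα g
  have hΓ : ∀ a : ℝ, 1 < a → 0 < Real.Gamma (1 - 1 / a) := fun a ha =>
    Real.Gamma_pos_of_pos (sub_pos.2 ((div_lt_one (zero_lt_one.trans ha)).2 ha))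
  have hγ : 0 < gammaOne α c ν s := by
    refine mul_pos (hΓ _ hmin) (Finset.sum_pos (fun j _ => ?_) ⟨g, ?_⟩)
    · exact mul_pos (hs j) (Real.rpow_pos_of_pos (mul_pos (hc j) (hν j)) _)
    · simp [minFlows, hg]
  have hlim := tendsto_of_chernoff_squeeze (f := F.missProb k) (zero_lt_one.trans hmin) hγ
    (Finset.sum_pos (fun k _ => hs k) Finset.univ_nonempty) (hν k)
    (tendsto_tsum_mul_one_sub_pow (mul_pos (hc k) (hν k)) (hα k)
      (fun i => F.prob_nonneg (F.item k i)) (fun i => F.prob_le_one (F.item k i))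
      (F.prob_item_isEquivalent hF (hν k) (hI k) (hq k)))
    (F.tendsto_expectedSize hF s hα hc hν hI hq)
    (fun n x θ hx hθ0 hθ => (F.missProb_bounds hF (fun k => (hs k).le) hν hI hsize k n hx hθ0 hθ).1)
    (fun n x θ hx hθ0 hθ => (F.missProb_bounds hF (fun k => (hs k).le) hν hI hsize k n hx hθ0 hθ).2)
  have hαk := hα k
  have hck := hc k
  have hνk := hν k
  have hα0 : 0 < α k := zero_lt_one.trans hαk
  have hb : minExponent α * (1 - 1 / α k) = minExponent α - minExponent α / α k := by ring
  rw [hb] at hlim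
  set b := minExponent α - minExponent α / α k
  have hγb := Real.rpow_pos_of_pos hγ b
  -- Uses `Γ(2 - 1/α) = (1 - 1/α) Γ(1 - 1/α)` and `(1 - 1/α) / (α - 1) = 1/α`.
  have hconst : (ν k)⁻¹ * (1 / α k * (c k * ν k) ^ (1 / α k) * Real.Gamma (1 - 1 / α k)) *
      gammaOne α c ν s ^ b = Real.Gamma (2 - 1 / α k) / (α k - 1) *
        (gammaOne α c ν s ^ b / (ν k * c k) ^ (1 - 1 / α k)) * c k := by
    have h1 : (2 : ℝ) - 1 / α k = (1 - 1 / α k) + 1 := by ring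
    have h2 : 1 - 1 / α k ≠ 0 := (sub_pos.2 ((div_lt_one hα0).2 hαk)).ne'
    have h3 : α k - 1 ≠ 0 := (sub_pos.2 hαk).ne'
    have hcν := mul_pos hνk hck
    have h4 := Real.rpow_pos_of_pos hcν (1 / α k)
    rw [h1, Real.Gamma_add_one h2, Real.rpow_sub hcν, Real.rpow_one, mul_comm (c k)]
    field_simp
  rw [hconst] at hlim
  set K := Real.Gamma (2 - 1 / α k) / (α k - 1) *
        (gammaOne α c ν s ^ b / (ν k * c k) ^ (1 - 1 / α k)) * c k with hK
  have hKpos : 0 < K := by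
    rw [← hconst]
    have := hΓ _ hαk
    have := Real.rpow_pos_of_pos (mul_pos hck hνk) (1 / α k)
    positivity
  have hdiv := hlim.div_const K
  rw [div_self hKpos.ne'] at hdiv
  refine isEquivalent_of_tendsto_one (hdiv.congr' ?_)
  filter_upwards [eventually_gt_atTop 0] with x hx
  have hxb := Real.rpow_pos_of_pos hx b
  rw [Pi.div_apply, ← mul_div_assoc, ← hK]
  field_simp

end CacheFlows

theorem corollary3 {Ω : Type*} [MeasurableSpace Ω] (P : Measure Ω) [IsProbabilityMeasure P]
    {D : Type*} [Countable D] [MeasurableSpace D] [DiscreteMeasurableSpace D]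
    {M : ℕ} (F : CacheFlows M D P) (hF : F.NonOverlapping)
    (α c ν s : Fin M → ℝ)
    (hα : ∀ k, 1 < α k) (hc : ∀ k, 0 < c k) (hs : ∀ k, 0 < s k)
    (hν : ∀ k, 0 < ν k) (hν_sum : ∑ k, ν k = 1)
    (hI : ∀ k, P.real {ω | F.I 0 ω = k} = ν k)
    (hq : ∀ k, F.popularity k ~[atTop] fun i : ℕ => c k / ((i : ℝ) + 1) ^ α k)
    (hsize : ∀ k i, F.size (F.item k i) = s k) :
    (∀ k ∈ minFlows α,
      F.missProb k ~[atTop] fun x : ℝ =>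
        Real.Gamma (2 - 1 / minExponent α) / (minExponent α - 1) *
          (gammaOne α c ν s ^ (minExponent α - 1) /
            (ν k * c k) ^ (1 - 1 / minExponent α)) *
          (c k / x ^ (minExponent α - 1))) ∧
    (∀ k ∉ minFlows α,
      F.missProb k ~[atTop] fun x : ℝ =>
        Real.Gamma (2 - 1 / α k) / (α k - 1) *
          (gammaOne α c ν s ^ (minExponent α - minExponent α / α k) /
            (ν k * c k) ^ (1 - 1 / α k)) *
          (c k / x ^ (minExponent α - minExponent α / α k))) := by
  have h := F.missProb_isEquivalent hF hα hc hs hν hI hq hsize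
  refine ⟨fun k hk => ?_, fun k _ => h k⟩
  have hk : α k = minExponent α := (Finset.mem_filter.1 hk).2
  have h0 : minExponent α ≠ 0 := hk ▸ (zero_lt_one.trans (hα k)).ne'
  simpa only [hk, div_self h0] using h k
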